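/- **Species.** A weighted species $\mathcal F^\omega$ assigns to every finite set $U$ a finite set $\mathcal F[U]$ of structures with weights $\omega\colon\mathcal F[U]\to\mathbb R_{\ge 0}$, and functorially to every bijection $\sigma\colon U\to V$ a weight-preserving bijection $\mathcal F[\sigma]\colon\mathcal F[U]\to\mathcal F[V]$. A structure in $\mathcal F[U]$ has size $|U|$. Write $\mathcal F[n]=\mathcal F[\{1,\dots,n\}]$, $\mathscr U(\mathcal F)=\bigsqcup_{n\ge 0}\mathcal F[n]$ and $\mathcal F^\omega(z)=\sum_{F\in\mathscr U(\mathcal F)}\omega(F)z^{|F|}/|F|!$. The derived species is $\mathcal F'[U]=\mathcal F[U\cup\{*\}]$, with the same weights $\omega$ and with the size not counting $*$. If $\mathcal G[\emptyset]=\emptyset$, the composition is $(\mathcal F\circ\mathcal G)[U]=\bigsqcup_\pi \mathcal F[\pi]\times\prod_{Q\in\pi}\mathcal G[Q]$, where $\pi$ runs over the partitions of $U$ into non-empty classes (components), with weight $\mu(F,(G_Q)_{Q\in\pi})=\omega(F)\prod_{Q\in\pi}\nu(G_Q)$. **Class $\mathscr S_d$.** For an integer $d\ge 1$, a power series $g(z)=\sum_n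 g_nz^n$ with non-negative coefficients and radius of convergence $0<\rho<\infty$ belongs to $\mathscr S_d$ if $g_n=0$ whenever $d\nmid n$, $g(\rho)<\infty$, and, as $n\to\infty$ along multiples of $d$, $$\frac{g_n}{g_{n+d}}\to\rho^d,\qquad \frac1{g_n}\sum_{i+j=n}g_ig_j\to 2g(\rho).$$ **Remainder.** Let $\mathcal F^\omega,\mathcal G^\nu$ be weighted species with $\mathcal G[\emptyset]=\emptyset$ and $[z^k]\mathcal F^\omega(z)>0$ for some $k\ge 1$. For $n\ge1$ with $[z^n](\mathcal F^\omega\circ\mathcal G^\nu)(z)>0$, sample $\mathsf S_n=(\mathsf F_n,(\mathsf G_Q)_{Q\in\pi_n})$ from $(\mathcal F\circ\mathcal G)[n]$ with probability proportional to its weight, choose $Q_0$ uniformly at random among the classes of $\pi_n$ of maximal size, relabel the atom $Q_0$ of $\mathsf F_n$ to $*$, delete $\mathsf G_{Q_0}$, and relabel $[n]\setminus Q_0$ by the order-preserving bijection onto $[n-|Q_0|]$. The result is the random structure $\mathsf R_n\in\mathscr U(\mathcal F'\circ\mathcal G)$. **Theorem.** Suppose that $\mathcal G^\nu(z)$ belongs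 to $\mathscr S_d$ with radius of convergence $\rho$, and that $\mathcal F^\omega(z)$ has radius of convergence strictly larger than $\mathcal G^\nu(\rho)$. Then $0<((\mathcal F')^\omega\circ\mathcal G^\nu)(\rho)<\infty$, and $\mathsf R_n$ is defined for all sufficiently large multiples $n$ of $d$. Let $\mathsf R$ be a random element of $\mathscr U(\mathcal F'\circ\mathcal G)$ with the Boltzmann distribution $$\mathbb P(\mathsf R=R)=\frac{\mu(R)\,\rho^{|R|}/|R|!}{((\mathcal F')^\omega\circ\mathcal G^\nu)(\rho)},\qquad R\in\mathscr U(\mathcal F'\circ\mathcal G).$$ Then $$d_{\mathrm{TV}}(\mathsf R_n,\mathsf R)=\sup_{\mathcal E\subseteq\mathscr U(\mathcal F'\circ\mathcal G)}|\mathbb P(\mathsf R_n\in\mathcal E)-\mathbb P(\mathsf R\in\mathcal E)|\to 0,\qquad n\to\infty,\quad n\equiv 0 \bmod d.$$ -/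

import Mathlib

open scoped NNReal ENNReal Nat

universe u v

noncomputable section

/-- A combinatorial species with non-negative weights. Structures on different label sets have
different types, so the disjointness convention `F[U] ∩ F[V] = ∅` for `U ≠ V` is built in. -/
structure WeightedSpecies where
  /-- the structures on a finite label set -/
  obj : (U : Type) → [Finite U] → Type u
  finite_obj : ∀ (U : Type) [Finite U], Finite (obj U)
  /-- transport of structures along a bijection of label sets -/
  map : ∀ {U V : Type} [Finite U] [Finite V], (U ≃ V) → obj U → obj V
  map_refl : ∀ {U : Type} [Finite U] (s : obj U), map (Equiv.refl U) s = s
  map_trans : ∀ {U V W : Type} [Finite U] [Finite V] [Finite W] (σ : U ≃ V) (τ : V ≃ W)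
    (s : obj U), map (σ.trans τ) s = map τ (map σ s)
  /-- the weight of a structure -/
  weight : ∀ {U : Type} [Finite U], obj U → ℝ≥0
  weight_map : ∀ {U V : Type} [Finite U] [Finite V] (σ : U ≃ V) (s : obj U),
    weight (map σ s) = weight s

/-- The unordered partitions of `U` into non-empty classes. -/
def SetPartition (U : Type) : Type := {π : Set (Set U) // Setoid.IsPartition π}

namespace SetPartition

instance (U : Type) [Finite U] : Finite (SetPartition U) :=
  inferInstanceAs (Finite {π : Set (Set U) // Setoid.IsPartition π})

/-- The partition `{σ(Q) | Q ∈ π}`; as `σ` is a bijection, `P` is a class of it iff `σ⁻¹(P) ∈ π`. -/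
def map {U V : Type} (σ : U ≃ V) (π : SetPartition U) : SetPartition V :=
  ⟨{P : Set V | σ ⁻¹' P ∈ π.1}, by
    refine ⟨fun h => π.2.1 (by simpa using h), fun a => ?_⟩
    obtain ⟨Q, ⟨hQ, haQ⟩, huniq⟩ := π.2.2 (σ.symm a)
    refine ⟨σ.symm ⁻¹' Q, ⟨?_, haQ⟩, ?_⟩
    · change σ ⁻¹' (σ.symm ⁻¹' Q) ∈ π.1
      rw [← Set.preimage_comp]
      simpa using hQ
    · rintro P ⟨hP, haP⟩
      have h := huniq (σ ⁻¹' P) ⟨hP, by simpa using haP⟩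
      rw [← h, ← Set.preimage_comp]
      simp⟩

/-- The bijection `π → {σ(Q) | Q ∈ π}`, `Q ↦ σ(Q)`. -/
def mapEquiv {U V : Type} (σ : U ≃ V) (π : SetPartition U) : ↥π.1 ≃ ↥(π.map σ).1 where
  toFun Q := ⟨σ '' Q.1, by
    change σ ⁻¹' (σ '' Q.1) ∈ π.1
    rw [σ.preimage_image]
    exact Q.2⟩
  invFun P := ⟨σ ⁻¹' P.1, P.2⟩
  left_inv Q := Subtype.ext (σ.preimage_image Q.1)
  right_inv P := Subtype.ext (σ.image_preimage P.1)

/-- The partition `π \ {Q₀}` of the complement of the class `Q₀`. -/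
def remove {U : Type} (π : SetPartition U) (Q₀ : ↥π.1) : SetPartition ↥(Q₀.1ᶜ) :=
  ⟨{P : Set ↥(Q₀.1ᶜ) | Subtype.val '' P ∈ π.1}, by
    refine ⟨fun h => π.2.1 (by simpa using h), fun a => ?_⟩
    obtain ⟨Q, ⟨hQ, haQ⟩, huniq⟩ := π.2.2 a.1
    have hne : Q ≠ Q₀.1 := fun h => a.2 (h ▸ haQ)
    have hsub : Q ⊆ Q₀.1ᶜ := fun x hx hx0 =>
      hne ((π.2.2 x).unique ⟨hQ, hx⟩ ⟨Q₀.2, hx0⟩)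
    have him : Subtype.val '' (Subtype.val ⁻¹' Q : Set ↥(Q₀.1ᶜ)) = Q := by
      rw [Subtype.image_preimage_coe]
      exact Set.inter_eq_right.2 hsub
    refine ⟨Subtype.val ⁻¹' Q, ⟨?_, haQ⟩, ?_⟩
    · change Subtype.val '' (Subtype.val ⁻¹' Q : Set ↥(Q₀.1ᶜ)) ∈ π.1
      rw [him]
      exact hQ
    · rintro P ⟨hP, haP⟩
      have h := huniq (Subtype.val '' P) ⟨hP, a, haP, rfl⟩
      rw [← h, Set.preimage_image_eq _ Subtype.val_injective]⟩

/-- The inverse of `γ : π → (π \ {Q₀}) ∪ {*}`: it sends `*` to `Q₀` and fixes all other classes. -/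
def unremove {U : Type} (π : SetPartition U) (Q₀ : ↥π.1) : Option ↥(π.remove Q₀).1 → ↥π.1
  | none => Q₀
  | some P => ⟨Subtype.val '' P.1, P.2⟩

theorem unremove_bijective {U : Type} (π : SetPartition U) (Q₀ : ↥π.1) :
    Function.Bijective (π.unremove Q₀) := by
  have key : ∀ P : ↥(π.remove Q₀).1, π.unremove Q₀ (some P) ≠ Q₀ := by
    intro P h
    obtain ⟨x, hx⟩ := Setoid.nonempty_of_mem_partition (π.remove Q₀).2 P.2
    have h1 : Subtype.val '' P.1 = Q₀.1 := congrArg Subtype.val h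
    have h2 : x.1 ∈ Subtype.val '' P.1 := ⟨x, hx, rfl⟩
    rw [h1] at h2
    exact x.2 h2
  constructor
  · rintro (_ | P) (_ | P') h
    · rfl
    · exact absurd h.symm (key P')
    · exact absurd h (key P)
    · have h1 : Subtype.val '' P.1 = Subtype.val '' P'.1 := congrArg Subtype.val h
      exact congrArg some (Subtype.ext (Subtype.val_injective.image_injective h1))
  · intro Q
    by_cases hne : Q = Q₀
    · exact ⟨none, hne.symm⟩
    · have hsub : Q.1 ⊆ Q₀.1ᶜ := fun x hx hx0 =>
        hne (Subtype.ext ((π.2.2 x).unique ⟨Q.2, hx⟩ ⟨Q₀.2, hx0⟩))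
      have him : Subtype.val '' (Subtype.val ⁻¹' Q.1 : Set ↥(Q₀.1ᶜ)) = Q.1 := by
        rw [Subtype.image_preimage_coe]
        exact Set.inter_eq_right.2 hsub
      refine ⟨some ⟨Subtype.val ⁻¹' Q.1, ?_⟩, Subtype.ext him⟩
      change Subtype.val '' (Subtype.val ⁻¹' Q.1 : Set ↥(Q₀.1ᶜ)) ∈ π.1
      rw [him]
      exact Q.2

/-- The bijection `γ : π → (π \ {Q₀}) ∪ {*}` with `γ(Q₀) = *` and `γ(Q) = Q` for `Q ≠ Q₀`. -/
def removeEquiv {U : Type} (π : SetPartition U) (Q₀ : ↥π.1) :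
    ↥π.1 ≃ Option ↥(π.remove Q₀).1 :=
  (Equiv.ofBijective (π.unremove Q₀) (π.unremove_bijective Q₀)).symm

end SetPartition

namespace WeightedSpecies

attribute [instance] finite_obj

/-- The exponential generating series. -/
def egs (F : WeightedSpecies.{u}) : PowerSeries ℝ :=
  PowerSeries.mk fun n => (∑' s : F.obj (Fin n), (F.weight s : ℝ)) / (n ! : ℝ)

/-- The set `⋃ₙ F[n]` of all structures on the label sets `[n]`, `n ≥ 0`. -/
def Structures (F : WeightedSpecies.{u}) : Type u := Σ n : ℕ, F.obj (Fin n)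

/-- The derived species: `F'[U] = F[U ∪ {*}]`. -/
def derived (F : WeightedSpecies.{u}) : WeightedSpecies.{u} where
  obj U _ := F.obj (Option U)
  finite_obj U _ := F.finite_obj (Option U)
  map σ s := F.map (Equiv.optionCongr σ) s
  map_refl s := by rw [Equiv.optionCongr_refl]; exact F.map_refl s
  map_trans σ τ s := by
    have h : Equiv.optionCongr (σ.trans τ)
        = (Equiv.optionCongr σ).trans (Equiv.optionCongr τ) := by
      ext1 x
      cases x <;> rfl
    rw [h]
    exact F.map_trans _ _ s
  weight s := F.weight s
  weight_map σ s := F.weight_map _ s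

section Comp

variable (F : WeightedSpecies.{u}) (G : WeightedSpecies.{v})

/-- Composite structures: a partition `π` of `U`, an `F`-structure on `π`, and a `G`-structure
on every class of `π`. -/
structure CompObj (U : Type) [Finite U] : Type (max u v) where
  /-- the partition -/
  part : SetPartition U
  /-- the structure on the set of classes -/
  outer : F.obj ↥part.1
  /-- the structures on the classes -/
  inner : ∀ Q : ↥part.1, G.obj ↥Q.1

variable {F G}

/-- The restriction `σ⁻¹(P) → P` of a bijection `σ`. -/
def restrictEquiv {U V : Type} (σ : U ≃ V) (P : Set V) : ↥(σ ⁻¹' P) ≃ ↥P :=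
  σ.subtypeEquiv fun _ => Iff.rfl

/-- Transport of composite structures along a bijection. -/
def CompObj.map {U V : Type} [Finite U] [Finite V] (σ : U ≃ V) (s : CompObj F G U) :
    CompObj F G V where
  part := s.part.map σ
  outer := F.map (s.part.mapEquiv σ) s.outer
  inner P := G.map (restrictEquiv σ P.1) (s.inner ⟨σ ⁻¹' P.1, P.2⟩)

/-- The weight of a composite structure. -/
def CompObj.weight {U : Type} [Finite U] (s : CompObj F G U) : ℝ≥0 :=
  F.weight s.outer * ∏ᶠ Q : ↥s.part.1, G.weight (s.inner Q)

theorem CompObj.finite (U : Type) [Finite U] : Finite (CompObj F G U) := by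
  let e : CompObj F G U → Σ π : SetPartition U, F.obj ↥π.1 × ∀ Q : ↥π.1, G.obj ↥Q.1 :=
    fun s => ⟨s.part, s.outer, s.inner⟩
  have (π : SetPartition U) : Finite (F.obj ↥π.1 × ∀ Q : ↥π.1, G.obj ↥Q.1) := inferInstance
  refine Finite.of_injective e ?_
  rintro ⟨p, o, i⟩ ⟨p', o', i'⟩ h
  simp only [e, Sigma.mk.injEq] at h
  obtain ⟨rfl, h⟩ := h
  simp only [heq_eq_eq, Prod.mk.injEq] at h
  rw [h.1, h.2]

theorem CompObj.map_refl {U : Type} [Finite U] (s : CompObj F G U) :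
    s.map (Equiv.refl U) = s := by
  obtain ⟨p, o, i⟩ := s
  have h1 : F.map (p.mapEquiv (Equiv.refl U)) o = o := by
    have : p.mapEquiv (Equiv.refl U) = Equiv.refl ↥p.1 := by
      ext1 Q
      exact Subtype.ext (Set.image_id Q.1)
    exact (congrArg (fun e => F.map e o) this).trans (F.map_refl o)
  have h2 : (fun P : ↥p.1 => G.map (restrictEquiv (Equiv.refl U) P.1) (i P)) = i := by
    funext P
    exact G.map_refl (i P)
  exact (congrArg (fun o' => CompObj.mk p o' _) h1).trans (congrArg (CompObj.mk p o) h2)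

theorem CompObj.map_trans {U V W : Type} [Finite U] [Finite V] [Finite W] (σ : U ≃ V) (τ : V ≃ W)
    (s : CompObj F G U) : s.map (σ.trans τ) = (s.map σ).map τ := by
  obtain ⟨p, o, i⟩ := s
  have h1 : F.map (p.mapEquiv (σ.trans τ)) o
      = F.map ((p.map σ).mapEquiv τ) (F.map (p.mapEquiv σ) o) := by
    have : p.mapEquiv (σ.trans τ) = (p.mapEquiv σ).trans ((p.map σ).mapEquiv τ) := by
      ext1 Q
      exact Subtype.ext (Set.image_comp τ σ Q.1)
    exact (congrArg (fun e => F.map e o) this).trans (F.map_trans _ _ o)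
  have h2 : (fun P : ↥((p.map σ).map τ).1 => G.map (restrictEquiv (σ.trans τ) P.1)
        (i ⟨σ ⁻¹' (τ ⁻¹' P.1), P.2⟩))
      = fun P : ↥((p.map σ).map τ).1 => G.map (restrictEquiv τ P.1) (G.map (restrictEquiv σ (τ ⁻¹' P.1))
        (i ⟨σ ⁻¹' (τ ⁻¹' P.1), P.2⟩)) := by
    funext P
    exact G.map_trans (restrictEquiv σ (τ ⁻¹' P.1)) (restrictEquiv τ P.1) _
  exact (congrArg (fun o' => CompObj.mk ((p.map σ).map τ) o' _) h1).trans
    (congrArg (CompObj.mk ((p.map σ).map τ) _) h2)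

theorem CompObj.weight_map {U V : Type} [Finite U] [Finite V] (σ : U ≃ V) (s : CompObj F G U) :
    (s.map σ).weight = s.weight := by
  unfold CompObj.weight
  congr 1
  · exact F.weight_map _ _
  · rw [← finprod_comp_equiv (s.part.mapEquiv σ).symm]
    exact finprod_congr fun P => G.weight_map _ _

variable (F G)

/-- The composition `F ∘ G`. (It is only used when `G[∅] = ∅`.) -/
def comp : WeightedSpecies.{max u v} where
  obj U _ := CompObj F G U
  finite_obj U _ := CompObj.finite U
  map σ s := s.map σ
  map_refl s := s.map_refl
  map_trans σ τ s := s.map_trans σ τ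
  weight s := s.weight
  weight_map σ s := s.weight_map σ

variable {F G}

/-- The `F' ∘ G`-structure on `U \ Q₀` that is left when the component `Q₀` is deleted: the atom
`Q₀` of the `F`-structure is relabelled to the placeholder `*`. -/
def CompObj.remove {U : Type} [Finite U] (s : CompObj F G U) (Q₀ : ↥s.part.1) :
    CompObj F.derived G ↥(Q₀.1ᶜ) where
  part := s.part.remove Q₀
  outer := F.map (s.part.removeEquiv Q₀) s.outer
  inner P := G.map (Equiv.Set.image Subtype.val P.1 Subtype.val_injective).symm
    (s.inner ⟨Subtype.val '' P.1, P.2⟩)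

/-- The unique order-preserving bijection from `A ⊆ [n]` to `[|A|]`. -/
def relabel {n : ℕ} (A : Set (Fin n)) : ↥A ≃ Fin (Nat.card ↥A) :=
  haveI := Fintype.ofFinite ↥A
  (monoEquivOfFin ↥A Nat.card_eq_fintype_card.symm).symm.toEquiv

/-- The remainder when the component `Q₀` is deleted from a composite structure on `[n]`,
relabelled in an order-preserving way. -/
def CompObj.remainder {n : ℕ} (s : CompObj F G (Fin n)) (Q₀ : ↥s.part.1) :
    (F.derived.comp G).Structures :=
  ⟨Nat.card ↥(Q₀.1ᶜ), (s.remove Q₀).map (relabel Q₀.1ᶜ)⟩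

/-- The components of maximal size. -/
def CompObj.largest {U : Type} [Finite U] (s : CompObj F G U) : Finset ↥s.part.1 :=
  (Set.toFinite {Q : ↥s.part.1 | ∀ Q' : ↥s.part.1, Nat.card ↥Q'.1 ≤ Nat.card ↥Q.1}).toFinset

theorem CompObj.largest_nonempty {U : Type} [Finite U] [Nonempty U] (s : CompObj F G U) :
    s.largest.Nonempty := by
  obtain ⟨Q, ⟨hQ, -⟩, -⟩ := s.part.2.2 (Classical.arbitrary U)
  have : Nonempty ↥s.part.1 := ⟨⟨Q, hQ⟩⟩
  obtain ⟨Q₀, h⟩ := Finite.exists_max (fun Q : ↥s.part.1 => Nat.card ↥Q.1)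
  exact ⟨Q₀, by simpa [CompObj.largest] using h⟩

end Comp

/-- The law of a structure sampled from `F[n]` with probability proportional to its weight,
for `n` with `[zⁿ]F(z) > 0`. -/
def gibbs (F : WeightedSpecies.{u}) (n : ℕ) (hn : 0 < PowerSeries.coeff n F.egs) :
    PMF (F.obj (Fin n)) :=
  PMF.normalize (fun s => (F.weight s : ℝ≥0∞))
    (by
      intro h
      rw [ENNReal.tsum_eq_zero] at h
      have h' : ∀ s : F.obj (Fin n), F.weight s = 0 := fun s => by exact_mod_cast h s
      simp [egs, h'] at hn)
    (by
      have := Fintype.ofFinite (F.obj (Fin n))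
      rw [tsum_fintype]
      exact ENNReal.sum_ne_top.2 fun _ _ => ENNReal.coe_ne_top)

/-- The law of the remainder `Rₙ`: sample `Sₙ` from `(F ∘ G)[n]` with probability proportional to
its weight, and delete a uniformly chosen component of maximal size. -/
def remainderLaw (F : WeightedSpecies.{u}) (G : WeightedSpecies.{v}) (n : ℕ) (hpos : 0 < n)
    (hn : 0 < PowerSeries.coeff n (F.comp G).egs) : PMF (F.derived.comp G).Structures :=
  haveI : Nonempty (Fin n) := ⟨⟨0, hpos⟩⟩
  ((F.comp G).gibbs n hn).bind fun s : CompObj F G (Fin n) =>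
    (PMF.uniformOfFinset s.largest s.largest_nonempty).map fun Q₀ => s.remainder Q₀

/-- The Boltzmann weight `ω(s) y^|s| / |s|!`. -/
def boltzmannWeight (F : WeightedSpecies.{u}) (y : ℝ≥0) (s : F.Structures) : ℝ≥0∞ :=
  ((F.weight s.2 * y ^ s.1 / (s.1 ! : ℝ≥0) : ℝ≥0) : ℝ≥0∞)

/-- `0 < F(y) < ∞`, where `F(y) = ∑ ω(s) y^|s| / |s|!`, the sum over all structures `s`. -/
def IsBoltzmannParameter (F : WeightedSpecies.{u}) (y : ℝ≥0) : Prop :=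
  (∑' s, F.boltzmannWeight y s) ≠ 0 ∧ (∑' s, F.boltzmannWeight y s) ≠ ∞

/-- The Boltzmann distribution `P(s) = F(y)⁻¹ ω(s) y^|s| / |s|!`. -/
def boltzmann (F : WeightedSpecies.{u}) (y : ℝ≥0) (h : F.IsBoltzmannParameter y) :
    PMF F.Structures :=
  PMF.normalize (F.boltzmannWeight y) h.1 h.2

end WeightedSpecies

/-- The radius of convergence of a real power series. -/
def radiusOfConvergence (g : PowerSeries ℝ) : ℝ≥0∞ :=
  (FormalMultilinearSeries.ofScalars ℝ fun n => PowerSeries.coeff n g).radius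

/-- The value `∑ gₙ xⁿ` of a power series (only used where the series converges). -/
def seriesValue (g : PowerSeries ℝ) (x : ℝ) : ℝ := ∑' n, PowerSeries.coeff n g * x ^ n

/-- The power series `g` belongs to the class `𝒮_d` of subexponential series with span `d`, and its
radius of convergence is `ρ`. -/
structure IsSubexponential (d : ℕ) (g : PowerSeries ℝ) (ρ : ℝ≥0) : Prop where
  one_le_span : 1 ≤ d
  coeff_nonneg : ∀ n, 0 ≤ PowerSeries.coeff n g
  radius_pos : 0 < ρ
  radius_eq : radiusOfConvergence g = ρ
  coeff_eq_zero : ∀ n, ¬ d ∣ n → PowerSeries.coeff n g = 0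
  tendsto_ratio : Filter.Tendsto
    (fun k : ℕ => PowerSeries.coeff (d * k) g / PowerSeries.coeff (d * k + d) g)
    Filter.atTop (nhds ((ρ : ℝ) ^ d))
  summable : Summable fun n => PowerSeries.coeff n g * (ρ : ℝ) ^ n
  tendsto_conv : Filter.Tendsto
    (fun k : ℕ => (∑ p ∈ Finset.HasAntidiagonal.antidiagonal (d * k),
      PowerSeries.coeff p.1 g * PowerSeries.coeff p.2 g) / PowerSeries.coeff (d * k) g)
    Filter.atTop (nhds (2 * seriesValue g ρ))

/-- The total variation distance `sup_E |p(E) - q(E)|` of two discrete distributions. -/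
def totalVariationDist {S : Type u} (p q : PMF S) : ℝ :=
  ⨆ E : Set S, |(p.toOuterMeasure E).toReal - (q.toOuterMeasure E).toReal|

end

/-! ### Subexponential sequences: products, convolution powers, compositions. -/

section Subexponential

open Filter Topology PowerSeries

/-! Fix a remainder `R` of size `m` and let `n > 2m`. If deleting a component leaves `R`, that
component has more than `n / 2` atoms, so it is the unique largest one and is chosen with
probability one. Composite structures with a marked component correspond to a set `Q`, a
`G`-structure on `Q` and an `F' ∘ G`-structure on the complement (`CompObj.markEquiv`,
`tsum_marked`). Counting them gives the exact formula P(Rₙ = R) = (μ(R)/m!) · [zⁿ⁻ᵐ]G / [zⁿ](F ∘ G)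
of `remainderLaw_apply`.

The limit of this quotient is analytic. Along multiples of `d`, [zⁿ](F ∘ G) ~ F'(G(ρ)) [zⁿ]G: each
power satisfies [zⁿ]Gᵏ ~ k G(ρ)ᵏ⁻¹ [zⁿ]G (`SubexpSeq.tendsto_pow`), and Kesten's bound
`SubexpSeq.exists_pow_le` allows dominated convergence in the sum over `k`, because F converges
beyond G(ρ) (`SubexpSeq.tendsto_comp`). Moreover [zⁿ⁻ᵐ]G / [zⁿ]G → ρᵐ when `d ∣ m`; other sizes
carry no weight.

Hence P(Rₙ = R) → μ(R) ρᵐ / (m! F'(G(ρ))). The total Boltzmann mass is exactly F'(G(ρ))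
(`tsum_boltzmannWeight_derived_comp`), so no mass escapes, and Scheffé's lemma
`PMF.tendsto_tsum_sub` upgrades pointwise convergence to total variation. -/

theorem tendsto_coeff_trunc_mul_div {a : PowerSeries ℝ}
    (hshift : ∀ j : ℕ, Tendsto (fun n => coeff (n - j) a / coeff n a) atTop (𝓝 1))
    (e : PowerSeries ℝ) (M : ℕ) :
    Tendsto (fun n => coeff n ((trunc M e : PowerSeries ℝ) * a) / coeff n a) atTop
      (𝓝 (∑ i ∈ Finset.range M, coeff i e)) := by
  have h : ∀ᶠ n in atTop, (∑ i ∈ Finset.range M, coeff i e * (coeff (n - i) a / coeff n a))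
      = coeff n ((trunc M e : PowerSeries ℝ) * a) / coeff n a := by
    filter_upwards [eventually_ge_atTop M] with n hn
    rw [coeff_mul, Finset.Nat.sum_antidiagonal_eq_sum_range_succ
      (fun i j => coeff i (trunc M e : PowerSeries ℝ) * coeff j a), Finset.sum_div]
    rw [← Finset.sum_subset (Finset.range_mono (show M ≤ n.succ by omega))]
    · refine Finset.sum_congr rfl fun i hi => ?_
      rw [Polynomial.coeff_coe, coeff_trunc, if_pos (Finset.mem_range.1 hi), mul_div_assoc]
    · intro i _ hi
      rw [Polynomial.coeff_coe, coeff_trunc, if_neg (by simpa using hi)]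
      simp
  refine Tendsto.congr' h ?_
  simpa using tendsto_finsetSum (Finset.range M)
    fun i _ => (hshift i).const_mul (coeff i e)

/-- Subexponential sequences with total mass `A`, written as power series. -/
structure SubexpSeq (a : PowerSeries ℝ) (A : ℝ) : Prop where
  nonneg : ∀ n, 0 ≤ coeff n a
  hasSum : HasSum (fun n => coeff n a) A
  ratio : Tendsto (fun n => coeff n a / coeff (n + 1) a) atTop (𝓝 1)
  conv : Tendsto (fun n => coeff n (a * a) / coeff n a) atTop (𝓝 (2 * A))

namespace SubexpSeq

variable {a : PowerSeries ℝ} {A : ℝ}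

theorem eventually_pos (h : SubexpSeq a A) : ∀ᶠ n in atTop, 0 < coeff n a := by
  filter_upwards [h.ratio.eventually (lt_mem_nhds zero_lt_one)] with n hn
  refine (h.nonneg n).lt_of_ne fun h0 => ?_
  simp [← h0] at hn

theorem mass_nonneg (h : SubexpSeq a A) : 0 ≤ A := h.hasSum.nonneg h.nonneg

theorem mass_pos (h : SubexpSeq a A) : 0 < A := by
  obtain ⟨n, hn⟩ := h.eventually_pos.exists
  exact hn.trans_le (le_hasSum h.hasSum n fun i _ => h.nonneg i)

theorem shift (h : SubexpSeq a A) (j : ℕ) :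
    Tendsto (fun n => coeff (n - j) a / coeff n a) atTop (𝓝 1) := by
  rw [← tendsto_add_atTop_iff_nat j]
  simp only [Nat.add_sub_cancel]
  induction j with
  | zero =>
    refine Tendsto.congr' ?_ tendsto_const_nhds
    filter_upwards [h.eventually_pos] with n hn
    simp [hn.ne']
  | succ j ih =>
    have h1 := ih.mul ((tendsto_add_atTop_iff_nat j).2 h.ratio)
    rw [mul_one] at h1
    refine Tendsto.congr' ?_ h1
    filter_upwards [(tendsto_add_atTop_nat j).eventually h.eventually_pos] with n hn
    rw [div_mul_div_cancel₀ hn.ne', add_assoc]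

/-- The head of `e` is a finite sum of shifts of `a`. Past a cut-off, |eₙ| ≤ ε aₙ, so the tail
contributes at most ε (a * a)ₙ, which `conv` bounds by a constant times ε aₙ. -/
theorem tendsto_mul_of_isLittleO (h : SubexpSeq a A) {e : PowerSeries ℝ} {E : ℝ}
    (hE : HasSum (fun n => coeff n e) E)
    (he : Tendsto (fun n => coeff n e / coeff n a) atTop (𝓝 0)) :
    Tendsto (fun n => coeff n (e * a) / coeff n a) atTop (𝓝 E) := by
  rw [Metric.tendsto_atTop']
  intro δ hδ
  have hA := h.mass_pos
  -- The three errors: the tail of `e`, the convergence of the head quotient, and the distance of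
  -- the partial sum from `E`.
  obtain ⟨ε, hε, hεδ⟩ : ∃ ε : ℝ, 0 < ε ∧ ε * (2 * A + 1) + ε + ε < δ := by
    refine ⟨δ / (2 * (2 * A + 3)), by positivity, ?_⟩
    have : δ / (2 * (2 * A + 3)) * (2 * A + 1) + δ / (2 * (2 * A + 3)) + δ / (2 * (2 * A + 3))
        = δ / 2 := by field_simp; ring
    linarith
  have h1 : ∀ᶠ n in atTop, |coeff n e| ≤ ε * coeff n a := by
    filter_upwards [h.eventually_pos, he.eventually (Metric.ball_mem_nhds 0 hε)] with n hn h2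
    rw [dist_zero_right, Real.norm_eq_abs, abs_div, abs_of_pos hn,
      div_lt_iff₀ hn] at h2
    exact h2.le
  obtain ⟨M, hM, hME⟩ : ∃ M : ℕ, (∀ n ≥ M, |coeff n e| ≤ ε * coeff n a) ∧
      |∑ i ∈ Finset.range M, coeff i e - E| < ε := by
    obtain ⟨M₁, hM₁⟩ := eventually_atTop.1 h1
    obtain ⟨M₂, hM₂⟩ := (Metric.tendsto_atTop.1 hE.tendsto_sum_nat) ε hε
    exact ⟨max M₁ M₂, fun n hn => hM₁ n (le_trans (le_max_left _ _) hn),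
      hM₂ _ (le_max_right _ _)⟩
  set e₁ : PowerSeries ℝ := (trunc M e : PowerSeries ℝ)
  have hrest : ∀ n, |coeff n (e - e₁)| ≤ ε * coeff n a := by
    intro n
    simp only [e₁, map_sub, Polynomial.coeff_coe, coeff_trunc]
    split_ifs with hn
    · simpa using mul_nonneg hε.le (h.nonneg n)
    · simpa using hM n (by omega)
  have h2 : ∀ n, |coeff n ((e - e₁) * a)| ≤ ε * coeff n (a * a) := by
    intro n
    rw [coeff_mul, coeff_mul, Finset.mul_sum]
    refine (Finset.abs_sum_le_sum_abs _ _).trans (Finset.sum_le_sum fun p _ => ?_)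
    rw [abs_mul, abs_of_nonneg (h.nonneg p.2), ← mul_assoc]
    exact mul_le_mul_of_nonneg_right (hrest _) (h.nonneg _)
  have h3 := tendsto_coeff_trunc_mul_div h.shift e M
  have h4 := h3.eventually (Metric.ball_mem_nhds _ hε)
  have h5 := h.conv.eventually (gt_mem_nhds (show 2 * A < 2 * A + 1 by linarith))
  obtain ⟨N, hN⟩ := eventually_atTop.1 (h.eventually_pos.and (h4.and h5))
  refine ⟨N, fun n hn => ?_⟩
  obtain ⟨hpos, hb, hc⟩ := hN n hn.le
  have hsplit : coeff n (e * a) / coeff n a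
      = coeff n (e₁ * a) / coeff n a + coeff n ((e - e₁) * a) / coeff n a := by
    rw [← add_div, ← map_add]
    congr 2
    ring
  have h6 : |coeff n ((e - e₁) * a) / coeff n a| ≤ ε * (2 * A + 1) := by
    rw [abs_div, abs_of_pos hpos]
    calc _ ≤ ε * coeff n (a * a) / coeff n a := by gcongr; exact h2 n
      _ = ε * (coeff n (a * a) / coeff n a) := by ring
      _ ≤ _ := by gcongr
  rw [Real.dist_eq] at hb
  rw [Real.dist_eq, hsplit]
  rw [abs_lt] at hb hME ⊢
  rw [abs_le] at h6
  constructor <;> linarith [hb.1, hb.2, hME.1, hME.2, h6.1, h6.2]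

/-- Write b = βa + e with e = o(a) and mass B - βA. The part βa contributes 2βA by `conv`, and `e`
contributes its own mass. -/
theorem tendsto_mul (h : SubexpSeq a A) {b : PowerSeries ℝ} {B β : ℝ}
    (hB : HasSum (fun n => coeff n b) B)
    (hb : Tendsto (fun n => coeff n b / coeff n a) atTop (𝓝 β)) :
    Tendsto (fun n => coeff n (b * a) / coeff n a) atTop (𝓝 (B + β * A)) := by
  have hE : HasSum (fun n => coeff n (b - C β * a)) (B - β * A) := by
    simpa using hB.sub (h.hasSum.mul_left β)
  have he : Tendsto (fun n => coeff n (b - C β * a) / coeff n a) atTop (𝓝 0) := by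
    have : Tendsto (fun n => coeff n b / coeff n a - β) atTop (𝓝 0) := by
      simpa using hb.sub_const β
    refine Tendsto.congr' ?_ this
    filter_upwards [h.eventually_pos] with n hn
    rw [map_sub, coeff_C_mul, sub_div, mul_div_cancel_right₀ _ hn.ne']
  have h1 := (h.tendsto_mul_of_isLittleO hE he).add (h.conv.const_mul β)
  have h2 : B - β * A + β * (2 * A) = B + β * A := by ring
  rw [h2] at h1
  refine h1.congr fun n => ?_
  rw [← mul_div_assoc, ← add_div, ← coeff_C_mul, ← map_add]
  congr 2
  ring

theorem pow_nonneg (h : SubexpSeq a A) (k n : ℕ) : 0 ≤ coeff n (a ^ k) := by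
  induction k generalizing n with
  | zero => rw [pow_zero, coeff_one]; split_ifs <;> simp
  | succ k ih =>
    rw [pow_succ, coeff_mul]
    exact Finset.sum_nonneg fun p _ => mul_nonneg (ih _) (h.nonneg _)

theorem hasSum_pow (h : SubexpSeq a A) (k : ℕ) : HasSum (fun n => coeff n (a ^ k)) (A ^ k) := by
  induction k with
  | zero =>
    have : HasSum (fun n => coeff n (1 : PowerSeries ℝ)) (coeff 0 (1 : PowerSeries ℝ)) :=
      hasSum_single 0 fun n hn => by simp [coeff_one, hn]
    simpa using this
  | succ k ih =>
    have h1 : Summable fun n => ‖coeff n (a ^ k)‖ := ih.summable.norm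
    have h2 : Summable fun n => ‖coeff n a‖ := h.hasSum.summable.norm
    have h3 := tsum_mul_tsum_eq_tsum_sum_antidiagonal_of_summable_norm h1 h2
    have h4 := (summable_norm_sum_mul_antidiagonal_of_summable_norm h1 h2).of_norm
    rw [ih.tsum_eq, h.hasSum.tsum_eq, ← pow_succ] at h3
    rw [h3]
    simp only [pow_succ, coeff_mul]
    exact h4.hasSum

/-- Induction by `tendsto_mul` with b = aᵏ: the limits obey Aᵏ + kAᵏ⁻¹·A = (k+1)Aᵏ. -/
theorem tendsto_pow (h : SubexpSeq a A) (k : ℕ) :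
    Tendsto (fun n => coeff n (a ^ k) / coeff n a) atTop (𝓝 (k * A ^ (k - 1))) := by
  induction k with
  | zero =>
    rw [Nat.cast_zero, zero_mul]
    refine Tendsto.congr' ?_ tendsto_const_nhds
    filter_upwards [eventually_ne_atTop 0] with n hn
    simp [coeff_one, hn]
  | succ k ih =>
    have h1 := h.tendsto_mul (h.hasSum_pow k) ih
    have h2 : A ^ k + k * A ^ (k - 1) * A = ((k + 1 : ℕ) : ℝ) * A ^ (k + 1 - 1) := by
      rcases k with _ | k
      · simp
      · simp [pow_succ]; ring
    rw [h2] at h1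
    simpa only [pow_succ] using h1

/-- Kesten's bound for the convolution powers of a subexponential sequence. -/
theorem exists_pow_le (h : SubexpSeq a A) {A' : ℝ} (hA' : A < A') :
    ∃ (N : ℕ) (D : ℝ), (∀ n ≥ N, 0 < coeff n a) ∧
      ∀ k : ℕ, ∀ n ≥ N, coeff n (a ^ k) ≤ k * D * A' ^ k * coeff n a := by
  have hA := h.mass_pos
  set ε := (A' - A) / 2
  have hε : 0 < ε := by simp only [ε]; linarith
  obtain ⟨N₁, hN₁⟩ := eventually_atTop.1 h.eventually_pos
  obtain ⟨N₂, hN₂⟩ := (Metric.tendsto_atTop.1 h.hasSum.tendsto_sum_nat) ε hε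
  -- `N ≥ 1` makes the coefficients of a⁰ = 1 vanish from `N` on, which starts the induction.
  set N := max (max N₁ N₂) 1
  have hpos : ∀ n ≥ N, 0 < coeff n a := fun n hn => hN₁ n (by omega)
  have hmass : A - ε < ∑ i ∈ Finset.range N, coeff i a := by
    have := hN₂ N (by omega)
    rw [Real.dist_eq, abs_lt] at this
    linarith [this.1]
  set t : PowerSeries ℝ := (trunc N a : PowerSeries ℝ)
  -- the part of `a * a` where one index is at least `N`
  have hlim : Tendsto (fun n => coeff n ((a - t) * a) / coeff n a) atTop
      (𝓝 (2 * A - ∑ i ∈ Finset.range N, coeff i a)) := by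
    refine (h.conv.sub (tendsto_coeff_trunc_mul_div h.shift a N)).congr fun n => ?_
    rw [sub_mul, map_sub, sub_div]
  have hlim2 : ∀ᶠ n in atTop, ∀ i ∈ Finset.range N, coeff (n - i) a / coeff n a < 2 :=
    (Filter.eventually_all_finset _).2
      fun i _ => (h.shift i).eventually (gt_mem_nhds one_lt_two)
  -- The head mass exceeds A - ε, so the limit in `hlim` is below A + ε < A'.
  obtain ⟨N₃, hN₃⟩ := eventually_atTop.1
    ((hlim.eventually (gt_mem_nhds (show _ < A' by simp only [ε] at hmass; linarith))).and hlim2)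
  obtain ⟨K, hK0, hK⟩ : ∃ K : ℝ, 0 ≤ K ∧ ∀ n ≥ N, n < N₃ → 1 ≤ K * coeff n a := by
    refine ⟨∑ n ∈ Finset.Ico N N₃, (coeff n a)⁻¹,
      Finset.sum_nonneg fun n _ => inv_nonneg.2 (h.nonneg n), fun n hn hn3 => ?_⟩
    rw [← inv_mul_cancel₀ (hpos n hn).ne']
    refine mul_le_mul_of_nonneg_right ?_ (h.nonneg n)
    exact Finset.single_le_sum (f := fun n => (coeff n a)⁻¹)
      (fun n _ => inv_nonneg.2 (h.nonneg n)) (Finset.mem_Ico.2 ⟨hn, hn3⟩)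
  have hA'0 : 0 < A' := hA.trans hA'
  -- `K` pays for the finitely many n in [N, N₃), where only the trivial bound A'ᵏ is available;
  -- 2/A' pays for the term 2A'ᵏ added at each induction step.
  set D := (2 / A' + K)
  have hD : 0 ≤ D := by positivity
  refine ⟨N, D, hpos, fun k => ?_⟩
  have hle : ∀ k n, coeff n (a ^ k) ≤ A' ^ k := fun k n =>
    (le_hasSum (h.hasSum_pow k) n fun i _ => h.pow_nonneg k i).trans
      (pow_le_pow_left₀ hA.le hA'.le k)
  have hlow : ∀ k M, ∑ i ∈ Finset.range M, coeff i (a ^ k) ≤ A' ^ k := fun k M =>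
    (sum_le_hasSum _ (fun i _ => h.pow_nonneg k i) (h.hasSum_pow k)).trans
      (pow_le_pow_left₀ hA.le hA'.le k)
  induction k with
  | zero =>
    intro n hn
    have : n ≠ 0 := by omega
    simp [coeff_one, this]
  | succ k ih =>
    intro n hn
    have hp := hpos n hn
    rcases lt_or_ge n N₃ with hn3 | hn3
    · calc coeff n (a ^ (k + 1)) ≤ A' ^ (k + 1) * 1 := by rw [mul_one]; exact hle _ _
        _ ≤ A' ^ (k + 1) * (K * coeff n a) := by gcongr; exact hK n hn hn3
        _ ≤ A' ^ (k + 1) * (((k + 1 : ℕ) * D) * coeff n a) := by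
          gcongr
          have h1 : K ≤ D := by simp only [D]; linarith [div_pos two_pos hA'0]
          have h2 : D ≤ (k + 1 : ℕ) * D := by
            push_cast; nlinarith [(Nat.cast_nonneg k : (0 : ℝ) ≤ k)]
          exact h1.trans h2
        _ = _ := by ring
    · obtain ⟨hc, hsh⟩ := hN₃ n hn3
      rw [div_lt_iff₀ hp] at hc
      -- Split according to the index taken from aᵏ. From `N` on, the induction hypothesis applies
      -- and costs a factor A'; below `N`, the other factor is at most 2aₙ and the mass of aᵏ is at
      -- most A'ᵏ.
      have hsplit : a ^ (k + 1)
          = (a ^ k - (trunc N (a ^ k) : PowerSeries ℝ)) * a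
            + (trunc N (a ^ k) : PowerSeries ℝ) * a := by ring
      have h1 : coeff n ((a ^ k - (trunc N (a ^ k) : PowerSeries ℝ)) * a)
          ≤ k * D * A' ^ k * coeff n ((a - t) * a) := by
        rw [coeff_mul, coeff_mul, Finset.mul_sum]
        refine Finset.sum_le_sum fun p _ => ?_
        rw [← mul_assoc]
        refine mul_le_mul_of_nonneg_right ?_ (h.nonneg _)
        simp only [t, map_sub, Polynomial.coeff_coe, coeff_trunc]
        split_ifs with hlt
        · simp
        · simpa using ih p.1 (by omega)
      have h2 : coeff n ((trunc N (a ^ k) : PowerSeries ℝ) * a) ≤ A' ^ k * (2 * coeff n a) := by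
        rw [coeff_mul, Finset.Nat.sum_antidiagonal_eq_sum_range_succ
          (fun i j => coeff i (trunc N (a ^ k) : PowerSeries ℝ) * coeff j a)]
        calc _ ≤ ∑ i ∈ Finset.range n.succ,
              coeff i (trunc N (a ^ k) : PowerSeries ℝ) * (2 * coeff n a) := by
              refine Finset.sum_le_sum fun i _ => ?_
              rw [Polynomial.coeff_coe, coeff_trunc]
              split_ifs with hi
              · have := hsh i (Finset.mem_range.2 hi)
                rw [div_lt_iff₀ hp] at this
                exact mul_le_mul_of_nonneg_left this.le (h.pow_nonneg k i)
              · simp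
          _ = (∑ i ∈ Finset.range n.succ, coeff i (trunc N (a ^ k) : PowerSeries ℝ))
              * (2 * coeff n a) := (Finset.sum_mul _ _ _).symm
          _ ≤ _ := by
              refine mul_le_mul_of_nonneg_right (le_trans (Finset.sum_le_sum fun i _ => ?_)
                (hlow k n.succ)) (by linarith)
              rw [Polynomial.coeff_coe, coeff_trunc]
              split_ifs
              · exact le_rfl
              · exact h.pow_nonneg k i
      rw [hsplit, map_add]
      calc _ ≤ k * D * A' ^ k * (A' * coeff n a) + A' ^ k * (2 * coeff n a) := by
            refine add_le_add (h1.trans ?_) h2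
            gcongr
        _ = (k * D + 2 / A') * A' ^ (k + 1) * coeff n a := by
            rw [pow_succ]; field_simp
        _ ≤ _ := by
            gcongr
            simp only [D]; push_cast; linarith

/-- Asymptotics of the coefficients of a composition `∑ fₖ aᵏ`. -/
theorem tendsto_comp (h : SubexpSeq a A) {f : ℕ → ℝ} {r : ℝ} (hr : A < r)
    (hf : Summable fun k => |f k| * r ^ k) :
    Tendsto (fun n => (∑' k, f k * coeff n (a ^ k)) / coeff n a) atTop
      (𝓝 (∑' k : ℕ, f k * (k * A ^ (k - 1)))) := by
  have hA := h.mass_pos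
  -- Kesten's bound at an intermediate A' leaves room to absorb the factor `k`: k A'ᵏ = O(rᵏ).
  obtain ⟨A', hA', hA'r⟩ := exists_between hr
  have hr0 : 0 < r := hA.trans hr
  obtain ⟨N, D, hpos, hle⟩ := h.exists_pow_le hA'
  -- Kesten's constant comes without a sign.
  have hD0 : 0 ≤ max D 0 := le_max_right _ _
  have hbdd : ∃ B : ℝ, ∀ k : ℕ, k * (A' / r) ^ k ≤ B := by
    have h1 : Tendsto (fun k : ℕ => (k : ℝ) * (A' / r) ^ k) atTop (𝓝 0) :=
      tendsto_self_mul_const_pow_of_lt_one (div_nonneg (hA.trans hA').le hr0.le)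
        ((div_lt_one hr0).2 hA'r)
    obtain ⟨B, hB⟩ := h1.bddAbove_range
    exact ⟨B, fun k => hB ⟨k, rfl⟩⟩
  obtain ⟨B, hB⟩ := hbdd
  have key : Tendsto (fun n => ∑' k, f k * (coeff n (a ^ k) / coeff n a)) atTop
      (𝓝 (∑' k : ℕ, f k * (k * A ^ (k - 1)))) := by
    refine tendsto_tsum_of_dominated_convergence (bound := fun k => |f k| * r ^ k * (B * max D 0))
      (hf.mul_right _) (fun k => (h.tendsto_pow k).const_mul _) ?_
    filter_upwards [eventually_ge_atTop N] with n hn k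
    have hp := hpos n hn
    rw [Real.norm_eq_abs, abs_mul, abs_of_nonneg (div_nonneg (h.pow_nonneg k n) hp.le), mul_assoc]
    refine mul_le_mul_of_nonneg_left ?_ (abs_nonneg _)
    rw [div_le_iff₀ hp]
    refine (hle k n hn).trans (mul_le_mul_of_nonneg_right ?_ hp.le)
    have hA'0 : 0 < A' := hA.trans hA'
    calc (k : ℝ) * D * A' ^ k ≤ k * max D 0 * A' ^ k := by gcongr; exact le_max_left _ _
      _ = r ^ k * ((k * (A' / r) ^ k) * max D 0) := by rw [div_pow]; field_simp
      _ ≤ _ := by gcongr; exact hB k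
  refine key.congr fun n => ?_
  simp_rw [← mul_div_assoc]
  rw [tsum_div_const]

end SubexpSeq

/-! ### Reduction to span 1 and radius 1. -/

namespace IsSubexponential

/-- The coefficients along the span, normalised by the radius of convergence. -/
noncomputable def spanSeries (d : ℕ) (g : PowerSeries ℝ) (ρ : ℝ≥0) : PowerSeries ℝ :=
  PowerSeries.mk fun k => coeff (d * k) g * (ρ : ℝ) ^ (d * k)

variable {d : ℕ} {g : PowerSeries ℝ} {ρ : ℝ≥0}

/-- `rescale` and `expand` are ring homomorphisms, so this single identity transfers all powers of
`g` to powers of the span series. -/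
theorem rescale_eq_expand (h : IsSubexponential d g ρ) (hd : d ≠ 0) :
    rescale (ρ : ℝ) g = expand d hd (spanSeries d g ρ) := by
  ext n
  rw [coeff_rescale]
  by_cases hn : d ∣ n
  · obtain ⟨k, rfl⟩ := hn
    rw [coeff_expand_mul, spanSeries, coeff_mk, mul_comm]
  · rw [h.coeff_eq_zero n hn, coeff_expand_of_not_dvd _ _ _ hn, mul_zero]

theorem coeff_pow_mul (h : IsSubexponential d g ρ) (j k : ℕ) :
    coeff (d * k) (g ^ j) * (ρ : ℝ) ^ (d * k) = coeff k (spanSeries d g ρ ^ j) := by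
  have hd : d ≠ 0 := by have := h.one_le_span; omega
  have h1 := congrArg (fun s => coeff (d * k) (s ^ j)) (h.rescale_eq_expand hd)
  simp only [← map_pow, coeff_rescale, coeff_expand_mul] at h1
  rw [mul_comm, h1]

theorem coeff_pow_eq_zero (h : IsSubexponential d g ρ) (j : ℕ) {n : ℕ} (hn : ¬ d ∣ n) :
    coeff n (g ^ j) = 0 := by
  have hd : d ≠ 0 := by have := h.one_le_span; omega
  have h1 := congrArg (fun s => coeff n (s ^ j)) (h.rescale_eq_expand hd)
  simp only [← map_pow, coeff_rescale, coeff_expand_of_not_dvd _ _ _ hn] at h1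
  have hρ : (ρ : ℝ) ≠ 0 := by exact_mod_cast h.radius_pos.ne'
  exact (mul_eq_zero.1 h1).resolve_left (pow_ne_zero _ hρ)

/-- The factor ρ^(dk) turns the ratio limit ρᵈ into 1 and cancels in the convolution quotient;
indices off the span contribute nothing to g(ρ). -/
theorem subexpSeq (h : IsSubexponential d g ρ) :
    SubexpSeq (spanSeries d g ρ) (seriesValue g ρ) := by
  have hd : d ≠ 0 := by have := h.one_le_span; omega
  have hρ : (ρ : ℝ) ≠ 0 := by exact_mod_cast h.radius_pos.ne'
  refine ⟨fun n => ?_, ?_, ?_, ?_⟩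
  · rw [spanSeries, coeff_mk]
    exact mul_nonneg (h.coeff_nonneg _) (by positivity)
  · have h1 : HasSum (fun n => coeff n g * (ρ : ℝ) ^ n) (seriesValue g ρ) := h.summable.hasSum
    have hinj : Function.Injective fun k : ℕ => d * k := fun _ _ h => mul_left_cancel₀ hd h
    have h2 := (hinj.hasSum_iff (f := fun n => coeff n g * (ρ : ℝ) ^ n) (a := seriesValue g ρ)
      (fun n hn => by
        rw [h.coeff_eq_zero n (fun ⟨k, hk⟩ => hn ⟨k, hk.symm⟩), zero_mul])).2 h1
    simpa [spanSeries, Function.comp_def] using h2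
  · have h1 := h.tendsto_ratio.div_const ((ρ : ℝ) ^ d)
    rw [div_self (pow_ne_zero _ hρ)] at h1
    refine h1.congr fun k => ?_
    rw [spanSeries, coeff_mk, coeff_mk, mul_add, mul_one, pow_add]
    field_simp
  · refine h.tendsto_conv.congr fun k => ?_
    rw [← pow_two, ← h.coeff_pow_mul 2 k, pow_two, coeff_mul, spanSeries, coeff_mk,
      mul_div_mul_right _ _ (pow_ne_zero _ hρ)]

end IsSubexponential

theorem exists_summable_of_lt_radius {f : PowerSeries ℝ} {A : ℝ} (hA : 0 ≤ A)
    (h : ENNReal.ofReal A < radiusOfConvergence f) :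
    ∃ r : ℝ, A < r ∧ Summable fun k => |coeff k f| * r ^ k := by
  obtain ⟨r, hAr, hr⟩ := ENNReal.lt_iff_exists_nnreal_btwn.1 h
  refine ⟨r, ?_, ?_⟩
  · exact (ENNReal.ofReal_lt_coe_iff hA).1 hAr
  · simpa [FormalMultilinearSeries.ofScalars_norm] using
      FormalMultilinearSeries.summable_norm_mul_pow _ hr

end Subexponential

/-! ### Removing and inserting a class of a partition. -/

namespace SetPartition

variable {U : Type}

theorem remove_injective {π π' : SetPartition U} {Q : Set U} (hQ : Q ∈ π.1) (hQ' : Q ∈ π'.1)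
    (h : π.remove ⟨Q, hQ⟩ = π'.remove ⟨Q, hQ'⟩) : π = π' := by
  have key : ∀ {π π' : SetPartition U} (hQ : Q ∈ π.1) (hQ' : Q ∈ π'.1),
      π.remove ⟨Q, hQ⟩ = π'.remove ⟨Q, hQ'⟩ → π.1 ⊆ π'.1 := by
    intro π π' hQ hQ' h P hP
    obtain ⟨x, hx⟩ := (π.unremove_bijective ⟨Q, hQ⟩).2 ⟨P, hP⟩
    rcases x with _ | x
    · have : Q = P := congrArg Subtype.val hx
      exact this ▸ hQ'
    · have h1 : Subtype.val '' x.1 = P := congrArg Subtype.val hx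
      have h2 : x.1 ∈ (π'.remove ⟨Q, hQ'⟩).1 := h ▸ x.2
      exact h1 ▸ h2
  exact Subtype.ext (Set.Subset.antisymm (key hQ hQ' h) (key hQ' hQ h.symm))

/-- Insert `Q` among the images of the classes of `p`; non-emptiness is needed for `Q` to be a
legitimate class. -/
theorem exists_remove_eq {Q : Set U} (hne : Q.Nonempty) (p : SetPartition ↥(Qᶜ)) :
    ∃ (π : SetPartition U) (hQ : Q ∈ π.1), π.remove ⟨Q, hQ⟩ = p := by
  have hpart : Setoid.IsPartition
      (insert Q ((fun P : Set ↥(Qᶜ) => Subtype.val '' P) '' p.1)) := by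
    constructor
    · rintro (h | ⟨P, hP, h⟩)
      · exact hne.ne_empty h.symm
      · have : P = ∅ := by simpa using h
        exact p.2.1 (this ▸ hP)
    · intro x
      by_cases hx : x ∈ Q
      · refine ⟨Q, ⟨Set.mem_insert _ _, hx⟩, ?_⟩
        rintro P ⟨(h | ⟨P, hP, rfl⟩), hxP⟩
        · exact h
        · obtain ⟨y, -, rfl⟩ := hxP
          exact absurd hx y.2
      · obtain ⟨P, ⟨hP, hxP⟩, huniq⟩ := p.2.2 ⟨x, hx⟩
        refine ⟨Subtype.val '' P, ⟨Set.mem_insert_of_mem _ ⟨P, hP, rfl⟩, ⟨_, hxP, rfl⟩⟩, ?_⟩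
        rintro P' ⟨(h | ⟨P', hP', rfl⟩), hxP'⟩
        · exact absurd (h ▸ hxP') hx
        · obtain ⟨y, hy, hyx⟩ := hxP'
          have hy' : y = ⟨x, hx⟩ := Subtype.ext hyx
          rw [huniq P' ⟨hP', hy' ▸ hy⟩]
  refine ⟨⟨_, hpart⟩, Set.mem_insert _ _, Subtype.ext ?_⟩
  ext P
  change Subtype.val '' P ∈ insert Q ((fun P : Set ↥(Qᶜ) => Subtype.val '' P) '' p.1) ↔ P ∈ p.1
  constructor
  · rintro (h | ⟨P', hP', h⟩)
    · obtain ⟨x, hx⟩ := hne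
      have hx' := hx
      rw [← h] at hx'
      obtain ⟨y, -, rfl⟩ := hx'
      exact absurd hx y.2
    · rwa [← Subtype.val_injective.image_injective h]
  · exact fun h => Set.mem_insert_of_mem _ ⟨P, h, rfl⟩

theorem card_remove [Finite U] (π : SetPartition U) (Q : ↥π.1) :
    Nat.card ↥π.1 = Nat.card ↥(π.remove Q).1 + 1 := by
  rw [Nat.card_congr (π.removeEquiv Q), Finite.card_option]

theorem card_map {V : Type} (σ : U ≃ V) (π : SetPartition U) :
    Nat.card ↥(π.map σ).1 = Nat.card ↥π.1 :=
  (Nat.card_congr (π.mapEquiv σ)).symm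

end SetPartition

/-! ### Composite structures with a marked component. -/

namespace WeightedSpecies

/-- Transport of structures along a bijection, as a bijection. -/
def objEquiv (F : WeightedSpecies.{u}) {U V : Type} [Finite U] [Finite V] (σ : U ≃ V) :
    F.obj U ≃ F.obj V where
  toFun := F.map σ
  invFun := F.map σ.symm
  left_inv s := by rw [← F.map_trans, σ.self_trans_symm, F.map_refl]
  right_inv s := by rw [← F.map_trans, σ.symm_trans_self, F.map_refl]

/-- The sum of the weights of all structures on `U`. -/
noncomputable def totalWeight (F : WeightedSpecies.{u}) (U : Type) [Finite U] : ℝ≥0∞ :=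
  ∑' s : F.obj U, (F.weight s : ℝ≥0∞)

theorem totalWeight_congr (F : WeightedSpecies.{u}) {U V : Type} [Finite U] [Finite V]
    (σ : U ≃ V) : F.totalWeight U = F.totalWeight V := by
  unfold totalWeight
  rw [← (F.objEquiv σ).tsum_eq]
  exact tsum_congr fun s => by rw [← F.weight_map σ s]; rfl

theorem totalWeight_ne_top (F : WeightedSpecies.{u}) (U : Type) [Finite U] :
    F.totalWeight U ≠ ∞ := by
  have := Fintype.ofFinite (F.obj U)
  rw [totalWeight, tsum_fintype]
  exact ENNReal.sum_ne_top.2 fun _ _ => ENNReal.coe_ne_top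

/-- The coefficients of the exponential generating series. -/
noncomputable def egsCoeff (F : WeightedSpecies.{u}) (n : ℕ) : ℝ≥0∞ :=
  F.totalWeight (Fin n) / (n ! : ℝ≥0∞)

section Comp

variable {F : WeightedSpecies.{u}} {G : WeightedSpecies.{v}} {U : Type} [Finite U]

theorem CompObj.mk_inj {p : SetPartition U} {o o' : F.obj ↥p.1} {i i' : ∀ Q : ↥p.1, G.obj ↥Q.1}
    (h : CompObj.mk p o i = CompObj.mk p o' i') : o = o' ∧ i = i' := by
  simpa using h

theorem CompObj.mk_congr {p : SetPartition U} {o o' : F.obj ↥p.1}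
    {i i' : ∀ Q : ↥p.1, G.obj ↥Q.1} (ho : o = o') (hi : i = i') :
    CompObj.mk p o i = CompObj.mk p o' i' := by
  rw [ho, hi]

theorem CompObj.weight_remove (s : CompObj F G U) (Q : ↥s.part.1) :
    s.weight = (s.remove Q).weight * G.weight (s.inner Q) := by
  have := Fintype.ofFinite ↥(s.part.remove Q).1
  have h1 : ∏ᶠ P : ↥s.part.1, G.weight (s.inner P)
      = (∏ᶠ P : ↥(s.part.remove Q).1, G.weight ((s.remove Q).inner P))
        * G.weight (s.inner Q) := by
    rw [← finprod_comp_equiv (s.part.removeEquiv Q).symm, finprod_eq_prod_of_fintype,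
      Fintype.prod_option, mul_comm, finprod_eq_prod_of_fintype]
    congr 1
    exact Finset.prod_congr rfl fun P _ => (G.weight_map _ _).symm
  have h2 : F.derived.weight (s.remove Q).outer = F.weight s.outer := F.weight_map _ _
  unfold CompObj.weight
  rw [h1, h2, mul_assoc]
  rfl

/-- Deleting the component `Q`, and remembering the structure on it. -/
noncomputable def CompObj.split (Q : Set U) (s : {s : CompObj F G U // Q ∈ s.part.1}) :
    CompObj F.derived G ↥(Qᶜ) × G.obj ↥Q :=
  (s.1.remove ⟨Q, s.2⟩, s.1.inner ⟨Q, s.2⟩)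

theorem CompObj.split_injective (Q : Set U) :
    Function.Injective (CompObj.split (F := F) (G := G) Q) := by
  rintro ⟨⟨p, o, i⟩, hQ⟩ ⟨⟨p', o', i'⟩, hQ'⟩ h
  obtain ⟨h1, h2⟩ := Prod.ext_iff.1 h
  have hp : p = p' := SetPartition.remove_injective hQ hQ' (congrArg CompObj.part h1)
  subst hp
  obtain ⟨ho, hi⟩ := CompObj.mk_inj h1
  have ho' : o = o' := (F.objEquiv (p.removeEquiv ⟨Q, hQ⟩)).injective ho
  have hi' : i = i' := by
    funext P
    obtain ⟨x, rfl⟩ := (p.unremove_bijective ⟨Q, hQ⟩).2 P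
    rcases x with _ | x
    · exact h2
    · exact (G.objEquiv _).injective (congrFun hi x)
  subst ho' hi'
  rfl

theorem CompObj.split_surjective (hG : IsEmpty (G.obj (Fin 0))) (Q : Set U) :
    Function.Surjective (CompObj.split (F := F) (G := G) Q) := by
  rintro ⟨⟨p, o, i⟩, g⟩
  -- This is where G[∅] = ∅ enters: the structure `g` on `Q` forces `Q` to be non-empty.
  have hne : Q.Nonempty := by
    by_contra hQ
    have : IsEmpty ↥Q := Set.isEmpty_coe_sort.2 (Set.not_nonempty_iff_eq_empty.1 hQ)
    exact hG.false (G.map (Equiv.equivOfIsEmpty ↥Q (Fin 0)) g)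
  obtain ⟨π, hQ, rfl⟩ := SetPartition.exists_remove_eq hne p
  let e := Equiv.ofBijective _ (π.unremove_bijective ⟨Q, hQ⟩)
  -- The inner family is defined over `Option`, where the marked class is `none`, and then
  -- transported along `e` to the classes of `π`.
  let j : ∀ x, G.obj ↥(e x).1 := fun x => match x with
    | none => g
    | some P => G.map (Equiv.Set.image Subtype.val P.1 Subtype.val_injective) (i P)
  obtain ⟨k, hk⟩ : ∃ k : ∀ P : ↥π.1, G.obj ↥P.1, ∀ x, k (e x) = j x :=
    ⟨Equiv.piCongrLeft (fun P : ↥π.1 => G.obj ↥P.1) e j,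
      Equiv.piCongrLeft_apply_apply (fun P : ↥π.1 => G.obj ↥P.1) e j⟩
  refine ⟨⟨⟨π, (F.objEquiv (π.removeEquiv ⟨Q, hQ⟩)).symm o, k⟩, hQ⟩, Prod.ext ?_ (hk none)⟩
  refine CompObj.mk_congr ((F.objEquiv (π.removeEquiv ⟨Q, hQ⟩)).apply_symm_apply o) ?_
  funext P
  exact (congrArg (G.map _) (hk (some P))).trans ((G.objEquiv _).symm_apply_apply (i P))

/-- A composite structure with a marked component is a set `Q`, a structure on the complement
of `Q`, and a structure on `Q`. -/
noncomputable def CompObj.markEquiv (hG : IsEmpty (G.obj (Fin 0))) :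
    (Σ s : CompObj F G U, ↥s.part.1) ≃ Σ Q : Set U, CompObj F.derived G ↥(Qᶜ) × G.obj ↥Q :=
  ((⟨fun x => ⟨x.2.1, x.1, x.2.2⟩, fun x => ⟨x.2.1, x.1, x.2.2⟩, fun _ => rfl, fun _ => rfl⟩ :
    (Σ s : CompObj F G U, ↥s.part.1) ≃ Σ Q : Set U, {s : CompObj F G U // Q ∈ s.part.1})).trans
  (Equiv.sigmaCongrRight fun Q => Equiv.ofBijective (CompObj.split Q)
    ⟨CompObj.split_injective Q, CompObj.split_surjective hG Q⟩)

theorem choose_eq_factorial_mul (m l : ℕ) :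
    ((m + l).choose m : ℝ≥0∞) = (m + l)! * ((m ! : ℝ≥0∞)⁻¹ * (l ! : ℝ≥0∞)⁻¹) := by
  have h : ((m + l).choose m : ℝ≥0∞) * m ! * l ! = (m + l)! := by
    have := Nat.choose_mul_factorial_mul_factorial (Nat.le_add_right m l)
    rw [Nat.add_sub_cancel_left] at this
    exact_mod_cast this
  have h1 : (m ! : ℝ≥0∞) * (m ! : ℝ≥0∞)⁻¹ = 1 :=
    ENNReal.mul_inv_cancel (by exact_mod_cast m.factorial_ne_zero) (ENNReal.natCast_ne_top _)
  have h2 : (l ! : ℝ≥0∞) * (l ! : ℝ≥0∞)⁻¹ = 1 :=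
    ENNReal.mul_inv_cancel (by exact_mod_cast l.factorial_ne_zero) (ENNReal.natCast_ne_top _)
  rw [← h]
  calc _ = ((m + l).choose m : ℝ≥0∞) * ((m ! : ℝ≥0∞) * (m ! : ℝ≥0∞)⁻¹)
        * ((l ! : ℝ≥0∞) * (l ! : ℝ≥0∞)⁻¹) := by rw [h1, h2, mul_one, mul_one]
    _ = _ := by ring

/-- The binomial coefficient is indexed by the size of the complement, hence the swap and the
symmetry of `Nat.choose`. -/
theorem sum_set_card {n : ℕ} (f : ℕ → ℕ → ℝ≥0∞) :
    ∑' Q : Set (Fin n), f (Nat.card ↥(Qᶜ)) (Nat.card ↥Q)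
      = ∑ p ∈ Finset.HasAntidiagonal.antidiagonal n, (n.choose p.1 : ℝ≥0∞) * f p.1 p.2 := by
  classical
  have h1 : ∀ S : Finset (Fin n),
      f (Nat.card ↥((Fintype.finsetEquivSet S)ᶜ)) (Nat.card ↥(Fintype.finsetEquivSet S))
        = f (n - S.card) S.card := by
    intro S
    have hS : Fintype.finsetEquivSet S = (S : Set (Fin n)) := rfl
    have h2 : Nat.card ↥((S : Set (Fin n))ᶜ) = n - S.card := by
      rw [← Finset.coe_compl, Nat.card_coe_set_eq, Set.ncard_coe_finset, Finset.card_compl,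
        Fintype.card_fin]
    rw [hS, h2, Nat.card_coe_set_eq, Set.ncard_coe_finset]
  rw [← (Fintype.finsetEquivSet (α := Fin n)).tsum_eq, tsum_fintype]
  simp_rw [h1]
  rw [← Finset.powerset_univ, Finset.sum_powerset_apply_card (fun k => f (n - k) k),
    Finset.card_univ, Fintype.card_fin, ← Finset.Nat.sum_antidiagonal_swap]
  rw [Finset.Nat.sum_antidiagonal_eq_sum_range_succ_mk]
  refine Finset.sum_congr rfl fun k hk => ?_
  have hk' : k ≤ n := by simpa [Nat.lt_succ_iff] using hk
  simp only [Prod.swap, nsmul_eq_mul, Nat.choose_symm hk']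

/-- Summing over the composite structures on `[n]` with a marked component. -/
theorem tsum_marked (hG : IsEmpty (G.obj (Fin 0))) (n : ℕ)
    (θ : (F.derived.comp G).Structures → ℝ≥0∞) :
    ∑' s : CompObj F G (Fin n), ∑' Q : ↥s.part.1, (s.weight : ℝ≥0∞) * θ (s.remainder Q)
      = n ! * ∑ p ∈ Finset.HasAntidiagonal.antidiagonal n,
        ((∑' R : CompObj F.derived G (Fin p.1), (R.weight : ℝ≥0∞) * θ ⟨p.1, R⟩) / p.1 !)
          * G.egsCoeff p.2 := by
  let Ψ : ℕ → ℝ≥0∞ := fun m =>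
    ∑' R : CompObj F.derived G (Fin m), (R.weight : ℝ≥0∞) * θ ⟨m, R⟩
  have hinner : ∀ Q : Set (Fin n),
      ∑' x : CompObj F.derived G ↥(Qᶜ) × G.obj ↥Q,
        ((x.1.weight : ℝ≥0∞) * G.weight x.2) * θ ⟨Nat.card ↥(Qᶜ), x.1.map (relabel Qᶜ)⟩
      = Ψ (Nat.card ↥(Qᶜ)) * G.totalWeight (Fin (Nat.card ↥Q)) := by
    intro Q
    rw [ENNReal.tsum_prod']
    -- Relabelling is a weight-preserving bijection, so the sum depends on `Q` only through its
    -- size.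
    have h1 : Ψ (Nat.card ↥(Qᶜ)) = ∑' r : CompObj F.derived G ↥(Qᶜ),
        (r.weight : ℝ≥0∞) * θ ⟨Nat.card ↥(Qᶜ), r.map (relabel Qᶜ)⟩ := by
      simp only [Ψ]
      refine (((F.derived.comp G).objEquiv (relabel Qᶜ)).tsum_eq _).symm.trans
        (tsum_congr fun r : CompObj F.derived G ↥(Qᶜ) => ?_)
      rw [← CompObj.weight_map (relabel Qᶜ) r]
      rfl
    rw [h1, ← G.totalWeight_congr (Finite.equivFin ↥Q), totalWeight, ← ENNReal.tsum_mul_right]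
    refine tsum_congr fun r => ?_
    rw [← ENNReal.tsum_mul_left]
    exact tsum_congr fun g => by ring
  calc _ = ∑' x : Σ s : CompObj F G (Fin n), ↥s.part.1,
        (x.1.weight : ℝ≥0∞) * θ (x.1.remainder x.2) :=
        (ENNReal.tsum_sigma' fun x : Σ s : CompObj F G (Fin n), ↥s.part.1 =>
          (x.1.weight : ℝ≥0∞) * θ (x.1.remainder x.2)).symm
    _ = ∑' y : Σ Q : Set (Fin n), CompObj F.derived G ↥(Qᶜ) × G.obj ↥Q,
        ((y.2.1.weight : ℝ≥0∞) * G.weight y.2.2)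
          * θ ⟨Nat.card ↥(y.1ᶜ), y.2.1.map (relabel y.1ᶜ)⟩ := by
        rw [← (CompObj.markEquiv hG).tsum_eq]
        refine tsum_congr fun x => ?_
        rw [x.1.weight_remove x.2, ENNReal.coe_mul]
        rfl
    _ = ∑' Q : Set (Fin n), Ψ (Nat.card ↥(Qᶜ)) * G.totalWeight (Fin (Nat.card ↥Q)) := by
        rw [ENNReal.tsum_sigma']
        exact tsum_congr hinner
    _ = _ := by
        rw [sum_set_card fun m l => Ψ m * G.totalWeight (Fin l), Finset.mul_sum]
        refine Finset.sum_congr rfl fun p hp => ?_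
        obtain rfl := Finset.HasAntidiagonal.mem_antidiagonal.1 hp
        rw [choose_eq_factorial_mul, egsCoeff, ENNReal.div_eq_inv_mul, ENNReal.div_eq_inv_mul]
        ring

/-! ### The generating series of a composition. -/

theorem egsCoeff_derived (F : WeightedSpecies.{u}) (k : ℕ) :
    F.derived.egsCoeff k = (k + 1 : ℕ) * F.egsCoeff (k + 1) := by
  have h1 : F.derived.totalWeight (Fin k) = F.totalWeight (Fin (k + 1)) :=
    F.totalWeight_congr (finSuccEquiv k).symm
  have h2 : ((k + 1 : ℕ) : ℝ≥0∞) * ((k + 1 : ℕ) : ℝ≥0∞)⁻¹ = 1 :=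
    ENNReal.mul_inv_cancel (by exact_mod_cast k.succ_ne_zero) (ENNReal.natCast_ne_top _)
  rw [egsCoeff, egsCoeff, h1, Nat.factorial_succ, Nat.cast_mul, ENNReal.div_eq_inv_mul,
    ENNReal.div_eq_inv_mul, ENNReal.mul_inv (Or.inr (ENNReal.natCast_ne_top _))
    (Or.inl (ENNReal.natCast_ne_top _)), ← mul_assoc, ← mul_assoc, h2, one_mul]

/-- The total weight of the composite structures on `[n]` with exactly `k` components. -/
noncomputable def compWeight (F : WeightedSpecies.{u}) (G : WeightedSpecies.{v}) (n k : ℕ) :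
    ℝ≥0∞ :=
  ∑' s : CompObj F G (Fin n), (s.weight : ℝ≥0∞) * if Nat.card ↥s.part.1 = k then 1 else 0

/-- Double counting: k + 1 components can be marked in k + 1 ways, and deleting the marked one
leaves `k`. The test function in `tsum_marked` is the indicator of `k` remaining components. -/
theorem compWeight_succ (hG : IsEmpty (G.obj (Fin 0))) (n k : ℕ) :
    (k + 1 : ℕ) * F.compWeight G n (k + 1)
      = n ! * ∑ p ∈ Finset.HasAntidiagonal.antidiagonal n,
        (F.derived.compWeight G p.1 k / p.1 !) * G.egsCoeff p.2 := by
  unfold compWeight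
  rw [← tsum_marked hG n (fun R => if Nat.card ↥(R.2 : CompObj F.derived G _).part.1 = k
    then 1 else 0), ← ENNReal.tsum_mul_left]
  refine tsum_congr fun s => ?_
  have h : ∀ Q : ↥s.part.1,
      (Nat.card ↥((s.remainder Q).2 : CompObj F.derived G _).part.1 = k)
        = (Nat.card ↥s.part.1 = k + 1) := by
    intro Q
    have h1 : Nat.card ↥((s.remainder Q).2 : CompObj F.derived G _).part.1
        = Nat.card ↥(s.part.remove Q).1 := SetPartition.card_map _ _
    rw [h1, s.part.card_remove Q, Nat.add_right_cancel_iff]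
  simp only [h]
  rw [ENNReal.tsum_const, ENat.card_eq_coe_natCard]
  split_ifs with hk
  · rw [hk]; push_cast; ring
  · simp

theorem compWeight_zero_zero : F.compWeight G 0 0 = F.totalWeight (Fin 0) := by
  have hempty : ∀ p : SetPartition (Fin 0), IsEmpty ↥p.1 := fun p => ⟨fun Q => by
    obtain ⟨x, -⟩ := Setoid.nonempty_of_mem_partition p.2 Q.2
    exact x.elim0⟩
  have hp₀ : Setoid.IsPartition (∅ : Set (Set (Fin 0))) := ⟨fun h => h, fun x => x.elim0⟩
  let p₀ : SetPartition (Fin 0) := ⟨∅, hp₀⟩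
  have := hempty p₀
  let e : F.obj ↥p₀.1 ≃ CompObj F G (Fin 0) := Equiv.ofBijective
    (fun o => ⟨p₀, o, fun Q => isEmptyElim Q⟩) (by
      constructor
      · intro o o' h
        simpa using h
      · rintro ⟨p, o, i⟩
        obtain rfl : p = p₀ := by
          have := hempty p
          exact Subtype.ext (Set.isEmpty_coe_sort.1 this)
        exact ⟨o, by
          simp only [CompObj.mk.injEq, heq_eq_eq, true_and]
          funext Q
          exact isEmptyElim Q⟩)
  rw [compWeight, ← F.totalWeight_congr (Equiv.equivOfIsEmpty ↥p₀.1 (Fin 0)), totalWeight,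
    ← e.tsum_eq]
  refine tsum_congr fun o => ?_
  have h1 : Nat.card ↥(e o).part.1 = 0 := by
    have := hempty (e o).part
    exact Nat.card_of_isEmpty
  have h2 : (e o).weight = F.weight o := by
    have h3 : ∏ᶠ Q : ↥p₀.1, G.weight ((e o).inner Q) = 1 := finprod_of_isEmpty _
    exact (congrArg (F.weight o * ·) h3).trans (mul_one _)
  rw [if_pos h1, mul_one, h2]

theorem compWeight_zero_of_ne {n : ℕ} (hn : n ≠ 0) : F.compWeight G n 0 = 0 := by
  rw [compWeight, ENNReal.tsum_eq_zero]
  intro s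
  rw [if_neg, mul_zero]
  obtain ⟨Q, ⟨hQ, -⟩, -⟩ := s.part.2.2 ⟨0, Nat.pos_of_ne_zero hn⟩
  have : Nonempty ↥s.part.1 := ⟨⟨Q, hQ⟩⟩
  exact Nat.card_pos.ne'

/-- Induction on `k` with `F` general, since deleting a component replaces F by F'. The factor k + 1
from marking cancels the one from differentiating. -/
theorem compWeight_eq (hG : IsEmpty (G.obj (Fin 0))) (n k : ℕ) :
    F.compWeight G n k
      = n ! * (F.egsCoeff k * PowerSeries.coeff n ((PowerSeries.mk G.egsCoeff) ^ k)) := by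
  induction k generalizing F n with
  | zero =>
    rcases eq_or_ne n 0 with rfl | hn
    · simp [compWeight_zero_zero, egsCoeff]
    · simp [compWeight_zero_of_ne hn, PowerSeries.coeff_one, hn]
  | succ k ih =>
    have h := compWeight_succ (F := F) hG n k
    have h1 : ∀ m : ℕ, F.derived.compWeight G m k / m !
        = (k + 1 : ℕ) * F.egsCoeff (k + 1)
          * PowerSeries.coeff m ((PowerSeries.mk G.egsCoeff) ^ k) := by
      intro m
      rw [ih, egsCoeff_derived, mul_comm (m ! : ℝ≥0∞), ENNReal.mul_div_cancel_right
        (by exact_mod_cast m.factorial_ne_zero) (ENNReal.natCast_ne_top _)]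
    simp only [h1, mul_assoc] at h
    rw [← Finset.mul_sum, ← Finset.mul_sum, mul_left_comm] at h
    have h2 := (ENNReal.mul_right_inj (by exact_mod_cast k.succ_ne_zero)
      (ENNReal.natCast_ne_top _)).1 h
    rw [h2, pow_succ, PowerSeries.coeff_mul]
    simp only [PowerSeries.coeff_mk]

/-- The generating series of a composition is the composition of the generating series. -/
theorem egsCoeff_comp (F : WeightedSpecies.{u}) (hG : IsEmpty (G.obj (Fin 0))) (n : ℕ) :
    (F.comp G).egsCoeff n
      = ∑' k, F.egsCoeff k * PowerSeries.coeff n ((PowerSeries.mk G.egsCoeff) ^ k) := by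
  have h : (F.comp G).totalWeight (Fin n) = ∑' k, F.compWeight G n k := by
    unfold compWeight
    rw [ENNReal.tsum_comm]
    refine tsum_congr fun s => ?_
    rw [ENNReal.tsum_mul_left, tsum_ite_eq', mul_one]
    rfl
  rw [egsCoeff, h]
  simp_rw [compWeight_eq hG]
  rw [ENNReal.tsum_mul_left, mul_comm, ENNReal.mul_div_cancel_right
    (by exact_mod_cast n.factorial_ne_zero) (ENNReal.natCast_ne_top _)]

end Comp

end WeightedSpecies

/-! ### Total variation distance and Scheffé's lemma. -/

section TotalVariation

open Filter Topology

variable {S : Type u}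

theorem PMF.toOuterMeasure_ne_top (p : PMF S) (E : Set S) : p.toOuterMeasure E ≠ ∞ := by
  rw [PMF.toOuterMeasure_apply]
  exact ne_top_of_le_ne_top p.tsum_coe_ne_top
    (ENNReal.tsum_le_tsum fun x => Set.indicator_le_self E p x)

theorem PMF.toOuterMeasure_toReal_sub_le (p q : PMF S) (E : Set S) :
    (q.toOuterMeasure E).toReal - (p.toOuterMeasure E).toReal ≤ (∑' x, (q x - p x)).toReal := by
  have hD : ∑' x, (q x - p x) ≠ ∞ :=
    ne_top_of_le_ne_top q.tsum_coe_ne_top (ENNReal.tsum_le_tsum fun x => tsub_le_self)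
  rw [sub_le_iff_le_add, ← ENNReal.toReal_add hD (p.toOuterMeasure_ne_top E)]
  refine ENNReal.toReal_mono (ENNReal.add_ne_top.2 ⟨hD, p.toOuterMeasure_ne_top E⟩) ?_
  rw [PMF.toOuterMeasure_apply, PMF.toOuterMeasure_apply, ← ENNReal.tsum_add]
  refine ENNReal.tsum_le_tsum fun x => ?_
  by_cases hx : x ∈ E
  · simp only [Set.indicator_of_mem hx]
    exact le_tsub_add
  · simp [Set.indicator_of_notMem hx]

theorem PMF.toOuterMeasure_toReal_compl (p : PMF S) (E : Set S) :
    (p.toOuterMeasure Eᶜ).toReal = 1 - (p.toOuterMeasure E).toReal := by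
  have h : p.toOuterMeasure E + p.toOuterMeasure Eᶜ = 1 := by
    rw [PMF.toOuterMeasure_apply, PMF.toOuterMeasure_apply, ← ENNReal.tsum_add, ← p.tsum_coe]
    exact tsum_congr fun x => Set.indicator_self_add_compl_apply E p x
  have h' := congrArg ENNReal.toReal h
  rw [ENNReal.toReal_add (p.toOuterMeasure_ne_top _) (p.toOuterMeasure_ne_top _), ENNReal.toReal_one] at h'
  linarith

/-- The positive part of q - p suffices: both laws have mass one, so passing to the complement of
the event reverses the sign. -/
theorem totalVariationDist_le (p q : PMF S) :
    totalVariationDist p q ≤ (∑' x, (q x - p x)).toReal := by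
  refine ciSup_le fun E => abs_le.2 ⟨?_, ?_⟩
  · linarith [p.toOuterMeasure_toReal_sub_le q E]
  · have := p.toOuterMeasure_toReal_sub_le q Eᶜ
    rw [PMF.toOuterMeasure_toReal_compl, PMF.toOuterMeasure_toReal_compl] at this
    linarith

/-- Scheffé's lemma. -/
theorem PMF.tendsto_tsum_sub (q : PMF S) {P : ℕ → S → ℝ≥0∞}
    (h : ∀ x, Tendsto (fun k => P k x) atTop (𝓝 (q x))) :
    Tendsto (fun k => (∑' x, (q x - P k x)).toReal) atTop (𝓝 0) := by
  have hq : ∀ x, q x ≠ ∞ := q.apply_ne_top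
  have h1 : ∀ k x, q x - P k x ≠ ∞ := fun k x => ne_top_of_le_ne_top (hq x) tsub_le_self
  -- Truncated subtraction gives q - P ≤ q, so `q` itself dominates and the P k need not be
  -- probability laws.
  have key : Tendsto (fun k => ∑' x, (q x - P k x).toReal) atTop (𝓝 (∑' _ : S, (0 : ℝ))) := by
    refine tendsto_tsum_of_dominated_convergence (bound := fun x => (q x).toReal)
      (ENNReal.summable_toReal q.tsum_coe_ne_top) (fun x => ?_) (Eventually.of_forall fun k x => ?_)
    · have h2 := ENNReal.Tendsto.sub (tendsto_const_nhds (x := q x)) (h x) (Or.inl (hq x))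
      rw [tsub_self] at h2
      simpa [Function.comp_def] using (ENNReal.tendsto_toReal ENNReal.zero_ne_top).comp h2
    · rw [Real.norm_of_nonneg ENNReal.toReal_nonneg]
      exact ENNReal.toReal_mono (hq x) tsub_le_self
  rw [tsum_zero] at key
  exact key.congr fun k => (ENNReal.tsum_toReal_eq (h1 k)).symm

end TotalVariation

/-! ### From extended non-negative to real coefficients. -/

namespace WeightedSpecies

theorem egsCoeff_ne_top (F : WeightedSpecies.{u}) (n : ℕ) : F.egsCoeff n ≠ ∞ :=
  ENNReal.div_ne_top (F.totalWeight_ne_top _) (by exact_mod_cast n.factorial_ne_zero)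

theorem coeff_egs (F : WeightedSpecies.{u}) (n : ℕ) :
    PowerSeries.coeff n F.egs = (F.egsCoeff n).toReal := by
  rw [egs, PowerSeries.coeff_mk, egsCoeff, ENNReal.toReal_div, totalWeight,
    ENNReal.tsum_toReal_eq fun _ => ENNReal.coe_ne_top]
  simp

theorem coeff_egs_nonneg (F : WeightedSpecies.{u}) (n : ℕ) : 0 ≤ PowerSeries.coeff n F.egs := by
  rw [coeff_egs]
  exact ENNReal.toReal_nonneg

/-- Both series are images of one series over `ℝ≥0` under semiring homomorphisms, which commute with
powers. -/
theorem coeff_mk_egsCoeff_pow (G : WeightedSpecies.{v}) (k n : ℕ) :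
    PowerSeries.coeff n ((PowerSeries.mk G.egsCoeff) ^ k)
      = ENNReal.ofReal (PowerSeries.coeff n (G.egs ^ k)) := by
  let g : PowerSeries ℝ≥0 := PowerSeries.mk fun n => (G.egsCoeff n).toNNReal
  have h1 : PowerSeries.mk G.egsCoeff = PowerSeries.map ENNReal.ofNNRealHom g := by
    ext n
    simp [g, ENNReal.coe_toNNReal (G.egsCoeff_ne_top n)]
  have h2 : G.egs = PowerSeries.map NNReal.toRealHom g := by
    ext n
    simp [g, coeff_egs, ENNReal.coe_toNNReal_eq_toReal]
  rw [h1, h2, ← map_pow, ← map_pow, PowerSeries.coeff_map, PowerSeries.coeff_map]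
  simp

theorem coeff_egs_pow_nonneg (G : WeightedSpecies.{v}) (k n : ℕ) :
    0 ≤ PowerSeries.coeff n (G.egs ^ k) := by
  induction k generalizing n with
  | zero => rw [pow_zero, PowerSeries.coeff_one]; split_ifs <;> simp
  | succ k ih =>
    rw [pow_succ, PowerSeries.coeff_mul]
    exact Finset.sum_nonneg fun p _ => mul_nonneg (ih _) (G.coeff_egs_nonneg _)

theorem coeff_egs_comp (F : WeightedSpecies.{u}) {G : WeightedSpecies.{v}}
    (hG : IsEmpty (G.obj (Fin 0))) (n : ℕ) :
    PowerSeries.coeff n (F.comp G).egs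
      = ∑' k, PowerSeries.coeff k F.egs * PowerSeries.coeff n (G.egs ^ k) := by
  rw [coeff_egs, egsCoeff_comp F hG, ENNReal.tsum_toReal_eq]
  · refine tsum_congr fun k => ?_
    rw [coeff_mk_egsCoeff_pow, ENNReal.toReal_mul, coeff_egs,
      ENNReal.toReal_ofReal (G.coeff_egs_pow_nonneg k n)]
  · intro k
    rw [coeff_mk_egsCoeff_pow]
    exact ENNReal.mul_ne_top (F.egsCoeff_ne_top k) ENNReal.ofReal_ne_top

/-! ### The exact law of the remainder at small structures. -/

section Law

variable {F : WeightedSpecies.{u}} {G : WeightedSpecies.{v}}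

/-- Classes are disjoint, so every other class lies in the complement of `Q₀`. -/
theorem CompObj.largest_eq_singleton {U : Type} [Finite U] (s : CompObj F G U) (Q₀ : ↥s.part.1)
    (h : Nat.card ↥(Q₀.1ᶜ) < Nat.card ↥Q₀.1) : s.largest = {Q₀} := by
  have hlt : ∀ Q : ↥s.part.1, Q ≠ Q₀ → Nat.card ↥Q.1 < Nat.card ↥Q₀.1 := by
    intro Q hne
    refine lt_of_le_of_lt ?_ h
    refine Nat.card_mono (Set.toFinite _) fun x hx hx0 => hne (Subtype.ext ?_)
    exact (s.part.2.2 x).unique ⟨Q.2, hx⟩ ⟨Q₀.2, hx0⟩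
  ext Q
  simp only [CompObj.largest, Set.Finite.mem_toFinset, Set.mem_ofPred_eq, Finset.mem_singleton]
  constructor
  · intro hQ
    by_contra hne
    exact absurd (hQ Q₀) (not_le.2 (hlt Q hne))
  · rintro rfl Q'
    by_cases hne : Q' = Q
    · rw [hne]
    · exact (hlt Q' hne).le

-- A component whose deletion leaves `R` fills more than half of [n], so it is the only largest one
-- and has probability one. The maximality constraint thus disappears, and the sum may run over all
-- components.
open Classical in
theorem uniform_largest_map_apply {n : ℕ} (s : CompObj F G (Fin n)) (hs : s.largest.Nonempty)
    (R : (F.derived.comp G).Structures) (hR : 2 * R.1 < n) :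
    ((PMF.uniformOfFinset s.largest hs).map fun Q₀ => s.remainder Q₀) R
      = ∑' Q : ↥s.part.1, if s.remainder Q = R then 1 else 0 := by
  rw [PMF.map_apply]
  refine tsum_congr fun Q => ?_
  by_cases hQ : s.remainder Q = R
  · have hc : Nat.card ↥(Q.1ᶜ) = R.1 := congrArg Sigma.fst hQ
    have hadd : Nat.card ↥Q.1 + Nat.card ↥(Q.1ᶜ) = n := by
      rw [Nat.card_coe_set_eq, Nat.card_coe_set_eq, Set.ncard_add_ncard_compl, Nat.card_fin]
    have hl := s.largest_eq_singleton Q (by omega)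
    rw [if_pos hQ, if_pos hQ.symm, PMF.uniformOfFinset_apply, if_pos (by rw [hl]; simp), hl]
    simp
  · rw [if_neg hQ, if_neg fun h => hQ h.symm]

/-- The law of the remainder, at structures of size less than `n / 2`. -/
theorem remainderLaw_apply (hG : IsEmpty (G.obj (Fin 0))) {n : ℕ} (hpos : 0 < n)
    (hn : 0 < PowerSeries.coeff n (F.comp G).egs) (R : (F.derived.comp G).Structures)
    (hR : 2 * R.1 < n) :
    remainderLaw F G n hpos hn R
      = (((F.derived.comp G).weight R.2 : ℝ≥0∞) / R.1 !) * G.egsCoeff (n - R.1)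
        / (F.comp G).egsCoeff n := by
  classical
  have hsum : ∀ m : ℕ, ∑' R' : CompObj F.derived G (Fin m),
      (R'.weight : ℝ≥0∞) * (if (⟨m, R'⟩ : (F.derived.comp G).Structures) = R then 1 else 0)
        = if m = R.1 then ((F.derived.comp G).weight R.2 : ℝ≥0∞) else 0 := by
    intro m
    obtain ⟨l, r⟩ := R
    split_ifs with hm
    · subst hm
      have : ∀ R' : CompObj F.derived G (Fin m),
          ((⟨m, R'⟩ : (F.derived.comp G).Structures) = ⟨m, r⟩) = (R' = r) := fun R' =>
        propext ⟨fun h => eq_of_heq (Sigma.mk.inj h).2, fun h => by rw [h]⟩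
      simp only [this, mul_ite, mul_one, mul_zero]
      exact tsum_ite_eq (r : CompObj F.derived G (Fin m)) _
    · rw [ENNReal.tsum_eq_zero]
      intro R'
      rw [if_neg, mul_zero]
      exact fun h => hm (congrArg Sigma.fst h)
  -- With the indicator of `R` as test function, only the term (R.1, n - R.1) of the antidiagonal
  -- survives.
  have hmark := (tsum_marked (F := F) hG n fun R' => if R' = R then 1 else 0).trans
    (congrArg ((n ! : ℝ≥0∞) * ·) (Finset.sum_congr rfl fun (p : ℕ × ℕ) _ =>
      congrArg (fun x => x / (p.1 ! : ℝ≥0∞) * G.egsCoeff p.2) (hsum p.1)))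
  rw [Finset.sum_eq_single (R.1, n - R.1)] at hmark
  · rw [if_pos rfl] at hmark
    have hlaw : remainderLaw F G n hpos hn R
        = (∑' s : CompObj F G (Fin n), ∑' Q : ↥s.part.1,
            (s.weight : ℝ≥0∞) * if s.remainder Q = R then 1 else 0)
          * ((F.comp G).totalWeight (Fin n))⁻¹ := by
      have : Nonempty (Fin n) := ⟨⟨0, hpos⟩⟩
      refine (PMF.bind_apply _ _ R).trans (Eq.trans ?_ ENNReal.tsum_mul_right)
      refine tsum_congr fun s : CompObj F G (Fin n) => ?_
      rw [uniform_largest_map_apply s (CompObj.largest_nonempty s) R hR,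
        ENNReal.tsum_mul_left, mul_right_comm]
      exact congrArg (· * _) (PMF.normalize_apply _ _ s)
    rw [hlaw, hmark, egsCoeff, egsCoeff]
    have h0 : (n ! : ℝ≥0∞) ≠ 0 := by exact_mod_cast n.factorial_ne_zero
    simp only [ENNReal.div_eq_inv_mul]
    rw [ENNReal.mul_inv (Or.inl (ENNReal.inv_ne_zero.2 (ENNReal.natCast_ne_top _)))
      (Or.inl (ENNReal.inv_ne_top.2 h0)), inv_inv]
    ring
  · rintro ⟨m, l⟩ hp hne
    have hml : m + l = n := Finset.HasAntidiagonal.mem_antidiagonal.1 hp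
    rw [if_neg, ENNReal.zero_div, zero_mul]
    rintro rfl
    exact hne (by rw [← hml, Nat.add_sub_cancel_left])
  · intro h
    exact absurd (Finset.HasAntidiagonal.mem_antidiagonal.2 (by simp; omega)) h

end Law

/-! ### The Boltzmann mass. -/

section Boltzmann

variable {F : WeightedSpecies.{u}} {G : WeightedSpecies.{v}} {d : ℕ} {ρ : ℝ≥0}

theorem boltzmannWeight_eq (F : WeightedSpecies.{u}) (y : ℝ≥0) (s : F.Structures) :
    F.boltzmannWeight y s = (F.weight s.2 : ℝ≥0∞) / (s.1 ! : ℝ≥0∞) * (y : ℝ≥0∞) ^ s.1 := by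
  have h0 : (s.1 ! : ℝ≥0) ≠ 0 := by exact_mod_cast s.1.factorial_ne_zero
  rw [boltzmannWeight, ENNReal.coe_div h0, ENNReal.coe_mul, ENNReal.coe_pow, ENNReal.coe_natCast,
    ENNReal.div_eq_inv_mul, ENNReal.div_eq_inv_mul]
  ring

theorem tsum_boltzmannWeight (F : WeightedSpecies.{u}) (y : ℝ≥0) :
    ∑' s, F.boltzmannWeight y s = ∑' n, F.egsCoeff n * (y : ℝ≥0∞) ^ n := by
  simp_rw [boltzmannWeight_eq]
  refine (ENNReal.tsum_sigma' _).trans (tsum_congr fun n => ?_)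
  dsimp only
  rw [ENNReal.tsum_mul_right, egsCoeff, totalWeight]
  simp only [ENNReal.div_eq_inv_mul]
  rw [ENNReal.tsum_mul_left]

theorem hasSum_egs_pow (hsub : IsSubexponential d G.egs ρ) (k : ℕ) :
    HasSum (fun n => PowerSeries.coeff n (G.egs ^ k) * (ρ : ℝ) ^ n) (seriesValue G.egs ρ ^ k) := by
  have hd : d ≠ 0 := by have := hsub.one_le_span; omega
  have hinj : Function.Injective fun k : ℕ => d * k := fun _ _ h => mul_left_cancel₀ hd h
  refine (hinj.hasSum_iff fun n hn => ?_).1 ?_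
  · rw [hsub.coeff_pow_eq_zero k (fun ⟨j, hj⟩ => hn ⟨j, hj.symm⟩), zero_mul]
  · simp only [Function.comp_def, hsub.coeff_pow_mul]
    exact hsub.subexpSeq.hasSum_pow k

theorem tsum_mk_egsCoeff_pow (hsub : IsSubexponential d G.egs ρ) (k : ℕ) :
    ∑' n, PowerSeries.coeff n ((PowerSeries.mk G.egsCoeff) ^ k) * (ρ : ℝ≥0∞) ^ n
      = ENNReal.ofReal (seriesValue G.egs ρ ^ k) := by
  have h := hasSum_egs_pow hsub k
  rw [← h.tsum_eq, ENNReal.ofReal_tsum_of_nonneg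
    (fun n => mul_nonneg (G.coeff_egs_pow_nonneg k n) (by positivity)) h.summable]
  refine tsum_congr fun n => ?_
  rw [coeff_mk_egsCoeff_pow, ENNReal.ofReal_mul (G.coeff_egs_pow_nonneg k n),
    ENNReal.ofReal_pow ρ.coe_nonneg, ENNReal.ofReal_coe_nnreal]

/-- The value `F'(A)` of the derivative of the generating series. -/
noncomputable def derivValue (F : WeightedSpecies.{u}) (A : ℝ) : ℝ :=
  ∑' k : ℕ, PowerSeries.coeff k F.egs * (k * A ^ (k - 1))

/-- The extra factor `k` is harmless because k (A/r)ᵏ is bounded for A < r. -/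
theorem summable_derivValue {A : ℝ} (hA : 0 < A)
    (hrad : ENNReal.ofReal A < radiusOfConvergence F.egs) :
    Summable fun k : ℕ => PowerSeries.coeff k F.egs * (k * A ^ (k - 1)) := by
  obtain ⟨r, hr, hs⟩ := exists_summable_of_lt_radius hA.le hrad
  have hr0 : 0 < r := hA.trans hr
  have h1 : Filter.Tendsto (fun k : ℕ => (k : ℝ) * (A / r) ^ k) Filter.atTop (nhds 0) :=
    tendsto_self_mul_const_pow_of_lt_one (div_nonneg hA.le hr0.le) ((div_lt_one hr0).2 hr)
  obtain ⟨B, hB⟩ := h1.bddAbove_range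
  refine Summable.of_nonneg_of_le
    (fun k => mul_nonneg (F.coeff_egs_nonneg k) (by positivity)) (fun k => ?_) (hs.mul_right (B / A))
  rw [abs_of_nonneg (F.coeff_egs_nonneg k), mul_assoc]
  refine mul_le_mul_of_nonneg_left ?_ (F.coeff_egs_nonneg k)
  have h2 : (k : ℝ) * (A / r) ^ k ≤ B := hB ⟨k, rfl⟩
  have h3 : (k : ℝ) * A ^ (k - 1) = r ^ k * ((k * (A / r) ^ k) / A) := by
    rcases k with _ | k
    · simp
    · rw [div_pow, pow_succ A, Nat.add_sub_cancel]
      field_simp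
  rw [h3]
  gcongr

theorem derivValue_pos {A : ℝ} (hA : 0 < A)
    (hrad : ENNReal.ofReal A < radiusOfConvergence F.egs)
    (hF : ∃ k : ℕ, 1 ≤ k ∧ 0 < PowerSeries.coeff k F.egs) : 0 < F.derivValue A := by
  obtain ⟨k, hk, hfk⟩ := hF
  refine (summable_derivValue hA hrad).tsum_pos
    (fun k => mul_nonneg (F.coeff_egs_nonneg k) (by positivity)) k ?_
  have : (0 : ℝ) < k := by exact_mod_cast hk
  positivity

/-- Interchanging non-negative sums gives F'(G(ρ)), the same constant as in the asymptotics of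
[zⁿ](F ∘ G); hence the pointwise limit is a probability law. -/
theorem tsum_boltzmannWeight_derived_comp (hG : IsEmpty (G.obj (Fin 0)))
    (hsub : IsSubexponential d G.egs ρ)
    (hrad : ENNReal.ofReal (seriesValue G.egs ρ) < radiusOfConvergence F.egs) :
    ∑' s, (F.derived.comp G).boltzmannWeight ρ s
      = ENNReal.ofReal (F.derivValue (seriesValue G.egs ρ)) := by
  have hA := hsub.subexpSeq.mass_pos
  set A := seriesValue G.egs ρ
  have hnn : ∀ k : ℕ, 0 ≤ PowerSeries.coeff k F.egs * (k * A ^ (k - 1)) :=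
    fun k => mul_nonneg (F.coeff_egs_nonneg k) (by positivity)
  -- The vanishing term k = 0 is split off because the coefficients of F' are shifted by one.
  rw [derivValue, ENNReal.ofReal_tsum_of_nonneg hnn (summable_derivValue hA hrad),
    tsum_eq_zero_add' ENNReal.summable, tsum_boltzmannWeight]
  simp_rw [egsCoeff_comp F.derived hG, ← ENNReal.tsum_mul_right]
  rw [ENNReal.tsum_comm]
  simp only [mul_assoc, ENNReal.tsum_mul_left, tsum_mk_egsCoeff_pow hsub, egsCoeff_derived]
  simp only [Nat.cast_zero, zero_mul, mul_zero, ENNReal.ofReal_zero, zero_add]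
  refine tsum_congr fun k => ?_
  rw [ENNReal.ofReal_mul (F.coeff_egs_nonneg _), ENNReal.ofReal_mul (Nat.cast_nonneg _),
    ENNReal.ofReal_natCast, coeff_egs, ENNReal.ofReal_toReal (F.egsCoeff_ne_top _),
    Nat.add_sub_cancel]
  ring

theorem weight_derived_comp_eq_zero (hG : IsEmpty (G.obj (Fin 0)))
    (hsub : IsSubexponential d G.egs ρ) (R : (F.derived.comp G).Structures) (hR : ¬ d ∣ R.1) :
    (F.derived.comp G).weight R.2 = 0 := by
  have h : (F.derived.comp G).egsCoeff R.1 = 0 := by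
    rw [egsCoeff_comp F.derived hG, ENNReal.tsum_eq_zero]
    intro k
    rw [coeff_mk_egsCoeff_pow, hsub.coeff_pow_eq_zero k hR, ENNReal.ofReal_zero, mul_zero]
  rw [egsCoeff, ENNReal.div_eq_zero_iff] at h
  have h1 := h.resolve_right (ENNReal.natCast_ne_top _)
  rw [totalWeight, ENNReal.tsum_eq_zero] at h1
  exact_mod_cast h1 R.2

end Boltzmann

/-! ### Pointwise convergence of the law and conclusion. -/

section Limit

open Filter Topology

variable {F : WeightedSpecies.{u}} {G : WeightedSpecies.{v}} {d : ℕ} {ρ : ℝ≥0}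

theorem tendsto_coeff_comp_div (hG : IsEmpty (G.obj (Fin 0))) (hsub : IsSubexponential d G.egs ρ)
    (hrad : ENNReal.ofReal (seriesValue G.egs ρ) < radiusOfConvergence F.egs) :
    Tendsto (fun k : ℕ => PowerSeries.coeff (d * k) (F.comp G).egs
        / PowerSeries.coeff (d * k) G.egs) atTop
      (𝓝 (F.derivValue (seriesValue G.egs ρ))) := by
  have hS := hsub.subexpSeq
  obtain ⟨r, hr, hs⟩ := exists_summable_of_lt_radius hS.mass_nonneg hrad
  refine (hS.tendsto_comp hr hs).congr fun k => ?_
  have hρ : (ρ : ℝ) ≠ 0 := by exact_mod_cast hsub.radius_pos.ne'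
  simp_rw [← hsub.coeff_pow_mul, ← mul_assoc]
  rw [tsum_mul_right, ← coeff_egs_comp F hG, ← pow_one (IsSubexponential.spanSeries d G.egs ρ),
    ← hsub.coeff_pow_mul, pow_one, mul_div_mul_right _ _ (pow_ne_zero _ hρ)]

/-- Divide the shift ratio of G, which tends to ρ^(dj), by the ratio of F ∘ G to G, which tends to
F'(G(ρ)) > 0. -/
theorem tendsto_coeff_sub_div (hG : IsEmpty (G.obj (Fin 0)))
    (hF : ∃ k : ℕ, 1 ≤ k ∧ 0 < PowerSeries.coeff k F.egs) (hsub : IsSubexponential d G.egs ρ)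
    (hrad : ENNReal.ofReal (seriesValue G.egs ρ) < radiusOfConvergence F.egs) (j : ℕ) :
    Tendsto (fun k : ℕ => PowerSeries.coeff (d * k - d * j) G.egs
        / PowerSeries.coeff (d * k) (F.comp G).egs) atTop
      (𝓝 ((ρ : ℝ) ^ (d * j) / F.derivValue (seriesValue G.egs ρ))) := by
  have hS := hsub.subexpSeq
  have hρ : (ρ : ℝ) ≠ 0 := by exact_mod_cast hsub.radius_pos.ne'
  have hL := (derivValue_pos hS.mass_pos hrad hF).ne'
  have h1 := ((hS.shift j).const_mul ((ρ : ℝ) ^ (d * j))).div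
    (tendsto_coeff_comp_div hG hsub hrad) hL
  rw [mul_one] at h1
  refine Tendsto.congr' ?_ h1
  filter_upwards [hS.eventually_pos, eventually_ge_atTop j] with k hk hjk
  have hgk : PowerSeries.coeff (d * k) G.egs ≠ 0 := by
    rintro h0
    rw [IsSubexponential.spanSeries, PowerSeries.coeff_mk, h0, zero_mul] at hk
    exact lt_irrefl _ hk
  have hpow : (ρ : ℝ) ^ (d * k) = (ρ : ℝ) ^ (d * j) * (ρ : ℝ) ^ (d * k - d * j) := by
    rw [← pow_add, Nat.add_sub_cancel' (Nat.mul_le_mul_left d hjk)]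
  simp only [Pi.div_apply, IsSubexponential.spanSeries, PowerSeries.coeff_mk]
  rw [Nat.mul_sub, hpow]
  field_simp

/-- The law of the remainder, extended by zero where the remainder is not defined. -/
noncomputable def remainderWeight (F : WeightedSpecies.{u}) (G : WeightedSpecies.{v}) (n : ℕ)
    (R : (F.derived.comp G).Structures) : ℝ≥0∞ :=
  open Classical in
  if h : ∃ _ : 0 < n, 0 < PowerSeries.coeff n (F.comp G).egs then
    remainderLaw F G n h.1 h.2 R else 0

theorem eventually_coeff_comp_pos (hG : IsEmpty (G.obj (Fin 0)))
    (hF : ∃ k : ℕ, 1 ≤ k ∧ 0 < PowerSeries.coeff k F.egs) (hsub : IsSubexponential d G.egs ρ)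
    (hrad : ENNReal.ofReal (seriesValue G.egs ρ) < radiusOfConvergence F.egs) :
    ∀ᶠ k : ℕ in atTop, 0 < PowerSeries.coeff (d * k) (F.comp G).egs := by
  have hL := derivValue_pos hsub.subexpSeq.mass_pos hrad hF
  filter_upwards [(tendsto_coeff_comp_div hG hsub hrad).eventually (lt_mem_nhds hL)] with k hk
  refine ((F.comp G).coeff_egs_nonneg _).lt_of_ne fun h0 => ?_
  simp [← h0] at hk

theorem tendsto_remainderWeight (hG : IsEmpty (G.obj (Fin 0)))
    (hF : ∃ k : ℕ, 1 ≤ k ∧ 0 < PowerSeries.coeff k F.egs) (hsub : IsSubexponential d G.egs ρ)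
    (hrad : ENNReal.ofReal (seriesValue G.egs ρ) < radiusOfConvergence F.egs)
    (hR : (F.derived.comp G).IsBoltzmannParameter ρ) (R : (F.derived.comp G).Structures) :
    Tendsto (fun k : ℕ => remainderWeight F G (d * k) R) atTop
      (𝓝 ((F.derived.comp G).boltzmann ρ hR R)) := by
  have hd := hsub.one_le_span
  have hL := derivValue_pos hsub.subexpSeq.mass_pos hrad hF
  have hev : ∀ᶠ k : ℕ in atTop, ((F.derived.comp G).weight R.2 : ℝ≥0∞) / R.1 !
      * (G.egsCoeff (d * k - R.1) / (F.comp G).egsCoeff (d * k)) = remainderWeight F G (d * k) R := by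
    filter_upwards [eventually_coeff_comp_pos hG hF hsub hrad, eventually_gt_atTop (2 * R.1)]
      with k hk hkR
    have hlt : 2 * R.1 < d * k := hkR.trans_le (Nat.le_mul_of_pos_left k hd)
    have hex : ∃ _ : 0 < d * k, 0 < PowerSeries.coeff (d * k) (F.comp G).egs :=
      ⟨by omega, hk⟩
    rw [remainderWeight, dif_pos hex, remainderLaw_apply hG _ _ R hlt, mul_div_assoc]
  refine Tendsto.congr' hev ?_
  rw [boltzmann, PMF.normalize_apply, tsum_boltzmannWeight_derived_comp hG hsub hrad,
    boltzmannWeight_eq, mul_assoc]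
  have hc : ((F.derived.comp G).weight R.2 : ℝ≥0∞) / R.1 ! ≠ ∞ :=
    ENNReal.div_ne_top ENNReal.coe_ne_top (by exact_mod_cast R.1.factorial_ne_zero)
  -- Ratio asymptotics exist only along the span; off it, `R` has weight zero and both sides vanish.
  by_cases hdR : d ∣ R.1
  · refine ENNReal.Tendsto.const_mul ?_ (Or.inr hc)
    obtain ⟨j, hj⟩ := hdR
    have h1 := ENNReal.tendsto_ofReal (tendsto_coeff_sub_div hG hF hsub hrad j)
    rw [ENNReal.ofReal_div_of_pos hL, ENNReal.ofReal_pow ρ.coe_nonneg, ENNReal.ofReal_coe_nnreal, ← hj,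
      div_eq_mul_inv] at h1
    refine Tendsto.congr' ?_ h1
    filter_upwards [eventually_coeff_comp_pos hG hF hsub hrad] with k hk
    rw [ENNReal.ofReal_div_of_pos hk, coeff_egs, coeff_egs,
      ENNReal.ofReal_toReal (egsCoeff_ne_top _ _), ENNReal.ofReal_toReal (egsCoeff_ne_top _ _)]
  · rw [weight_derived_comp_eq_zero hG hsub R hdR]
    simp

end Limit

end WeightedSpecies

theorem theorem3p1 (F : WeightedSpecies.{u}) (G : WeightedSpecies.{v})
    (hG : IsEmpty (G.obj (Fin 0)))
    (hF : ∃ k : ℕ, 1 ≤ k ∧ 0 < PowerSeries.coeff k F.egs)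
    (d : ℕ) (ρ : ℝ≥0) (hsub : IsSubexponential d G.egs ρ)
    (hrad : ENNReal.ofReal (seriesValue G.egs ρ) < radiusOfConvergence F.egs) :
    ∃ hR : (F.derived.comp G).IsBoltzmannParameter ρ,
      ∀ ε : ℝ, 0 < ε → ∀ᶠ n : ℕ in Filter.atTop, d ∣ n →
        ∃ (hpos : 0 < n) (hn : 0 < PowerSeries.coeff n (F.comp G).egs),
          totalVariationDist (WeightedSpecies.remainderLaw F G n hpos hn)
            ((F.derived.comp G).boltzmann ρ hR) < ε := by
  have hL := WeightedSpecies.derivValue_pos hsub.subexpSeq.mass_pos hrad hF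
  have hR : (F.derived.comp G).IsBoltzmannParameter ρ := by
    rw [WeightedSpecies.IsBoltzmannParameter,
      WeightedSpecies.tsum_boltzmannWeight_derived_comp hG hsub hrad]
    exact ⟨(ENNReal.ofReal_pos.2 hL).ne', ENNReal.ofReal_ne_top⟩
  refine ⟨hR, fun ε hε => ?_⟩
  have hd := hsub.one_le_span
  have htv := PMF.tendsto_tsum_sub _
    (WeightedSpecies.tendsto_remainderWeight hG hF hsub hrad hR)
  obtain ⟨K, hK⟩ := Filter.eventually_atTop.1 ((htv.eventually (gt_mem_nhds hε)).and
    (WeightedSpecies.eventually_coeff_comp_pos hG hF hsub hrad))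
  -- `K + 1` rather than `K` also guarantees n > 0.
  filter_upwards [Filter.eventually_ge_atTop (d * (K + 1))] with n hn hdn
  obtain ⟨k, rfl⟩ := hdn
  have hk : K + 1 ≤ k := Nat.le_of_mul_le_mul_left hn hd
  obtain ⟨h1, h2⟩ := hK k (by omega)
  have hpos : 0 < d * k := Nat.mul_pos hd (by omega)
  refine ⟨hpos, h2, (totalVariationDist_le _ _).trans_lt ?_⟩
  have hex : ∃ _ : 0 < d * k, 0 < PowerSeries.coeff (d * k) (F.comp G).egs := ⟨hpos, h2⟩
  simpa only [WeightedSpecies.remainderWeight, dif_pos hex] using h1
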